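/- **Theorem (shape control for the three-edge star).** Let $\Omega$ be a star with central vertex $v_0$ and edges $e_1,e_2,e_3$ of lengths $l_1,l_2,l_3>0$. Identify $e_j$ with $(0,l_j)$, so that $x=0$ is $v_0$ and $x=l_j$ is the leaf $v_j$, and write $\partial u_j(v_0,t)=\partial_x u_j(0,t)$. Let $q_j$ be a real continuous function on $[0,l_j]$ for $j=1,2,3$. For $T>0$, $f_1\in H^1_0(0,T)$ and $f_2\in L^2(0,T)$ let $u^{\mathbf f}=u$, $\mathbf f=(f_1,f_2)$, be the weak solution, with $u_j\in C([0,T];H^1(0,l_j))\cap C^1([0,T];L^2(0,l_j))$, of $$u_{tt}-u_{xx}+q(x)u=0 \ \text{ on each } e_j,\ 0<t<T,\qquad u(\cdot,0)=u_t(\cdot,0)=0,$$ $$u_1(v_1,t)=f_1(t),\qquad u_2(v_2,t)=u_3(v_3,t)=0,$$ $$\partial u_2(v_0,t)-\partial u_1(v_0,t)=f_2(t),\qquad \partial u_3(v_0,t)-\partial u_1(v_0,t)=0,\qquad \sum_{j=1}^3u_j(v_0,t)=0 .$$ Here weak means that there are $g_1,g_2,g_3\in L^2(0,T)$, which play the role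 of $\partial u_j(v_0,\cdot)$ in the two conditions on the derivatives (required for almost every $t$), such that for every $j$, every $y\in H^1(0,l_j)$ with $y(l_j)=0$, and every $t\in[0,T]$, $$\int_0^{l_j}\partial_tu_j(x,t)\,y(x)\,dx=-\int_0^t\Big(\int_0^{l_j}\big(\partial_xu_j(x,s)\,y'(x)+q_j(x)u_j(x,s)y(x)\big)\,dx+g_j(s)y(0)\Big)ds .$$ Let $\mathcal H^1_0$ be the space of the functions $\phi$ on $\Omega$ whose restriction $\phi_j$ to $e_j$ belongs to $H^1(0,l_j)$ for each $j$ and which satisfy $\phi_1(v_1)=\phi_2(v_2)=\phi_3(v_3)=0$ and $\sum_{j=1}^3\phi_j(v_0)=0$, and let $\|\phi\|_{\mathcal H^1}^2=\sum_{j=1}^3\big(\|\phi_j'\|_{L^2(e_j)}^2+\|\phi_j\|_{L^2(e_j)}^2\big)$. Put $T_*=\max(l_2,\,l_1+l_3)$. There is a constant $C$, depending only on $q$ and $l_1,l_2,l_3$, such that for every $T\ge T_*$ and every $\phi\in\mathcal H^1_0$ there are controls $f_1\in H^1_0(0,T)$ and $f_2\in L^2(0,T)$ with $$u^{\mathbf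 f}(x,T)=\phi(x)\quad\text{for all } x\in\Omega,\qquad \|f_1\|_{H^1(0,T)}+\|f_2\|_{L^2(0,T)}\le C\,\|\phi\|_{\mathcal H^1}.$$ -/

import Mathlib

open Set Filter Topology MeasureTheory

noncomputable section

/-- Membership in `L²(a, b)`. -/
def MemL2 (a b : ℝ) (f : ℝ → ℝ) : Prop :=
  MemLp f 2 (volume.restrict (Ioo a b))

/-- The norm of `L²(a, b)`, for `a ≤ b`. -/
def l2Norm (a b : ℝ) (f : ℝ → ℝ) : ℝ :=
  √(∫ x in a..b, f x ^ 2)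

/-- Membership in the Sobolev space `H¹(a, b)`, for `a < b`, in terms of the continuous
representative: `f` is absolutely continuous on `[a, b]` and its almost everywhere defined
classical derivative, which is then its weak derivative, belongs to `L²(a, b)`. -/
def MemH1 (a b : ℝ) (f : ℝ → ℝ) : Prop :=
  AbsolutelyContinuousOnInterval f a b ∧ MemL2 a b (deriv f)

/-- The norm of `H¹(a, b)`. -/
def h1Norm (a b : ℝ) (f : ℝ → ℝ) : ℝ :=
  √(∫ x in a..b, (deriv f x ^ 2 + f x ^ 2))

/-- Membership in `H¹₀(a, b)`. -/
def MemH10 (a b : ℝ) (f : ℝ → ℝ) : Prop :=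
  MemH1 a b f ∧ f a = 0 ∧ f b = 0

/-- The function `u`, with `u t x` its value at time `t` and position `x`, belongs to
`C([0, T]; H¹(0, ℓ))`. -/
def ContinuousIntoH1 (ℓ T : ℝ) (u : ℝ → ℝ → ℝ) : Prop :=
  (∀ t ∈ Icc 0 T, MemH1 0 ℓ (u t)) ∧
  ∀ t ∈ Icc 0 T,
    Tendsto (fun s => h1Norm 0 ℓ (fun x => u s x - u t x)) (𝓝[Icc 0 T] t) (𝓝 0)

/-- The function `v` belongs to `C([0, T]; L²(0, ℓ))`. -/
def ContinuousIntoL2 (ℓ T : ℝ) (v : ℝ → ℝ → ℝ) : Prop :=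
  (∀ t ∈ Icc 0 T, MemL2 0 ℓ (v t)) ∧
  ∀ t ∈ Icc 0 T,
    Tendsto (fun s => l2Norm 0 ℓ (fun x => v s x - v t x)) (𝓝[Icc 0 T] t) (𝓝 0)

/-- At every time in `[0, T]`, `v` is the derivative of `u` with respect to time, as a curve
in `L²(0, ℓ)` (one-sided at the two end times). -/
def IsTimeDerivative (ℓ T : ℝ) (u v : ℝ → ℝ → ℝ) : Prop :=
  ∀ t ∈ Icc 0 T,
    Tendsto (fun s => l2Norm 0 ℓ (fun x => (u s x - u t x) / (s - t) - v t x))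
      (𝓝[Icc 0 T \ {t}] t) (𝓝 0)

/-- `u` is a finite energy weak solution, in `C([0, T]; H¹(0, ℓ)) ∩ C¹([0, T]; L²(0, ℓ))`, of
`u_tt - u_xx + q u = 0` on `(0, ℓ) × (0, T)`, `u(·, 0) = u_t(·, 0) = 0`, `u_x(0, ·) = g`.
The equation and the condition on `u_x(0, ·)` are tested with the `y` in `H¹(0, ℓ)` that vanish
at `ℓ` and integrated over time from `0` to `t`. No boundary condition at `ℓ` is imposed here. -/
def IsWeakEdgeSolution (ℓ T : ℝ) (q g : ℝ → ℝ) (u : ℝ → ℝ → ℝ) : Prop :=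
  ContinuousIntoH1 ℓ T u ∧ MemL2 0 T g ∧ (∀ x ∈ Icc 0 ℓ, u 0 x = 0) ∧
  ∃ v : ℝ → ℝ → ℝ, ContinuousIntoL2 ℓ T v ∧ IsTimeDerivative ℓ T u v ∧
    (∀ᵐ x ∂(volume.restrict (Ioo 0 ℓ)), v 0 x = 0) ∧
    ∀ y : ℝ → ℝ, MemH1 0 ℓ y → y ℓ = 0 → ∀ t ∈ Icc 0 T,
      (∫ x in (0 : ℝ)..ℓ, v t x * y x) =
        -∫ s in (0 : ℝ)..t,
          ((∫ x in (0 : ℝ)..ℓ, (deriv (u s) x * deriv y x + q x * u s x * y x)) + g s * y 0)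

/-- `u` solves, on `[0, T]`, the wave equation with potential `q` on the star with three edges of
lengths `ℓ 0, ℓ 1, ℓ 2`, with zero initial data, boundary control `f₁` and internal control `f₂`.
The indices `0, 1, 2` stand for the edges `e₁, e₂, e₃`; on each edge `x = 0` is the centre and
`x = ℓ j` the leaf. The function `g j` is the derivative of `u j` at the centre, along the edge
in the direction away from the centre. -/
def IsStarSolution (ℓ : Fin 3 → ℝ) (q : Fin 3 → ℝ → ℝ) (T : ℝ) (f₁ f₂ : ℝ → ℝ)
    (u : Fin 3 → ℝ → ℝ → ℝ) : Prop :=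
  (∃ g : Fin 3 → ℝ → ℝ,
    (∀ j, IsWeakEdgeSolution (ℓ j) T (q j) (g j) (u j)) ∧
    (∀ᵐ t ∂(volume.restrict (Ioo 0 T)), g 1 t - g 0 t = f₂ t) ∧
    (∀ᵐ t ∂(volume.restrict (Ioo 0 T)), g 2 t - g 0 t = 0)) ∧
  (∀ t ∈ Icc 0 T, u 0 t (ℓ 0) = f₁ t) ∧
  (∀ t ∈ Icc 0 T, u 1 t (ℓ 1) = 0) ∧
  (∀ t ∈ Icc 0 T, u 2 t (ℓ 2) = 0) ∧
  (∀ t ∈ Icc 0 T, ∑ j, u j t 0 = 0)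

/-- The space `𝓗¹₀` on the star: `H¹` on every edge, zero at the leaves, and the sum of the
three values at the centre is zero. -/
def MemStarH10 (ℓ : Fin 3 → ℝ) (φ : Fin 3 → ℝ → ℝ) : Prop :=
  (∀ j, MemH1 0 (ℓ j) (φ j)) ∧ (∀ j, φ j (ℓ j) = 0) ∧ ∑ j, φ j 0 = 0

/-- The norm of `𝓗¹` on the star. -/
def starH1Norm (ℓ : Fin 3 → ℝ) (φ : Fin 3 → ℝ → ℝ) : ℝ :=
  √(∑ j, h1Norm 0 (ℓ j) (φ j) ^ 2)

end

/-! Control of the shape of a star of three strings.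

The proof combines d'Alembert's formula with one fixed point theorem. All waves have the form
`F (t - x) + G (t + x) + R x t`: the travelling parts `F`, `G` are explicit functions of class
`H¹`, and the potential only enters through the scattered part `R`, which is continuously
differentiable. It solves `R_tt - R_xx = k (W + R)`, with `k = -q` and `W` the travelling part, and
is found, by `exists_volterra_wave`, as the solution of a Volterra equation in a norm that is
weighted exponentially in time. The source `k (W + R)` may jump across vertical and horizontal
lines of the plane, such as the centre of the star, so Duhamel's integral is treated with integrated
equations (`C1Wave`, `c1Wave_duhamel`).

Exchanging space and time turns the control of the shape of a string from one end into an initial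
boundary value problem that starts at the other end: the distance to that end is the new time, the
prescribed shape a boundary datum, and the initial state of rest is zero by finite speed of
propagation (`exists_shape_control_wave`). The controlling wave is never reflected.

On the star, at the time `T = max (ℓ 1) (ℓ 0 + ℓ 2)`, this is used twice (`exists_star_waves`).
* The value `p` of the wave at the centre end of the edge `1` controls the shape of that edge,
  because `ℓ 1 ≤ T`.
* The edges `0` and `2`, with the sign of the wave changed on the edge `2`, form one string of
  length `ℓ 0 + ℓ 2`. The condition on the sum of the values at the centre says that the
  displacement of this string jumps by `p`, and the equality of the derivatives on the edges `0`
  and `2` says that its slope does not jump. The wave produced by the jump `p`, reflected at the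
  leaf of the edge `2`, is `exists_jump_wave`. What is missing from the prescribed shape is
  continuous across the centre, by `∑ j, φ j 0 = 0`, and vanishes at the leaf of the edge `2`; it is
  produced from the leaf of the edge `0`, because `ℓ 0 + ℓ 2 ≤ T`.

The controls are read off: `f₁` is the value at the leaf of the edge `0`, and `f₂` is the difference
of the derivatives at the centre. For later times the whole wave is delayed, which keeps the
constant. That the waves are weak solutions is `EnergyWave.isWeakEdgeSolution`: the balance law on
rectangles is integrated by parts against the impulse of the flux.
-/

/-! ### Integrals of bounded measurable functions -/

lemma intervalIntegrable_of_bounded {g : ℝ → ℝ} {M : ℝ} (hg : Measurable g)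
    (hM : ∀ x, |g x| ≤ M) (a b : ℝ) : IntervalIntegrable g volume a b := by
  rw [intervalIntegrable_iff]
  exact Measure.integrableOn_of_bounded (M := M) (by simp [uIoc]) hg.aestronglyMeasurable
    (Eventually.of_forall hM)

lemma integrableOn_box_of_bounded {F : ℝ → ℝ → ℝ} {M : ℝ} (hF : Measurable F.uncurry)
    (hM : ∀ x y, |F x y| ≤ M) (a b c d : ℝ) :
    IntegrableOn F.uncurry (uIoc a b ×ˢ uIoc c d) := by
  refine Measure.integrableOn_of_bounded (M := M) ?_ hF.aestronglyMeasurable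
    (Eventually.of_forall fun p => hM p.1 p.2)
  rw [Measure.volume_eq_prod, Measure.prod_prod]
  exact ENNReal.mul_ne_top (by simp [uIoc]) (by simp [uIoc])

lemma measurable_intervalIntegral {F : ℝ → ℝ → ℝ} (hF : Measurable F.uncurry) (a b : ℝ) :
    Measurable fun x => ∫ y in a..b, F x y := by
  unfold intervalIntegral
  exact (StronglyMeasurable.integral_prod_right hF.stronglyMeasurable).measurable.sub
    (StronglyMeasurable.integral_prod_right hF.stronglyMeasurable).measurable

lemma abs_intervalIntegral_le {g : ℝ → ℝ} {M a b : ℝ} (h : ∀ x, |g x| ≤ M) :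
    |∫ x in a..b, g x| ≤ M * |b - a| :=
  (Real.norm_eq_abs _).symm.trans_le
    (intervalIntegral.norm_integral_le_of_norm_le_const fun x _ => h x)

lemma intervalIntegrable_intervalIntegral {F : ℝ → ℝ → ℝ} {M : ℝ} (hF : Measurable F.uncurry)
    (hM : ∀ x y, |F x y| ≤ M) (a b c d : ℝ) :
    IntervalIntegrable (fun x => ∫ y in a..b, F x y) volume c d :=
  intervalIntegrable_of_bounded (measurable_intervalIntegral hF a b)
    (fun x => abs_intervalIntegral_le (hM x)) c d

lemma intervalIntegral_swap_of_bounded {F : ℝ → ℝ → ℝ} {M : ℝ} (hF : Measurable F.uncurry)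
    (hM : ∀ x y, |F x y| ≤ M) (a b c d : ℝ) :
    ∫ x in a..b, ∫ y in c..d, F x y = ∫ y in c..d, ∫ x in a..b, F x y :=
  intervalIntegral_intervalIntegral_swap (integrableOn_box_of_bounded hF hM a b c d)

/-- Fubini's theorem on the triangle `0 < τ < s < t`. -/
lemma intervalIntegral_triangle_swap {G : ℝ → ℝ → ℝ} {M : ℝ} (hG : Measurable G.uncurry)
    (hM : ∀ x y, |G x y| ≤ M) {t : ℝ} (ht : 0 ≤ t) :
    IntervalIntegrable (fun τ => ∫ s in τ..t, G s τ) volume 0 t ∧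
    ∫ s in (0 : ℝ)..t, ∫ τ in (0 : ℝ)..s, G s τ = ∫ τ in (0 : ℝ)..t, ∫ s in τ..t, G s τ := by
  set H : ℝ → ℝ → ℝ := fun s τ => if τ < s then G s τ else 0 with hH
  have hHm : Measurable H.uncurry :=
    Measurable.ite (measurableSet_lt measurable_snd measurable_fst) hG measurable_const
  have hHm' : Measurable (fun τ s => H s τ).uncurry := hHm.comp measurable_swap
  have hHb : ∀ x y, |H x y| ≤ M := by
    intro x y
    have := hM x y
    simp only [hH]
    split_ifs
    · exact this
    · simpa using (abs_nonneg _).trans this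
  have h1 : ∀ s ∈ uIcc 0 t, ∫ τ in (0 : ℝ)..s, G s τ = ∫ τ in (0 : ℝ)..t, H s τ := by
    intro s hs
    rw [uIcc_of_le ht] at hs
    have hi := fun a b => intervalIntegrable_of_bounded (hHm.comp (measurable_prodMk_left (x := s)))
      (fun y => hHb s y) a b
    have hadd := intervalIntegral.integral_add_adjacent_intervals (hi 0 s) (hi s t)
    simp only [Function.comp_def, Function.uncurry_apply_pair] at hadd
    rw [← hadd]
    have e1 : ∫ τ in s..t, H s τ = 0 := by
      rw [intervalIntegral.integral_congr (g := fun _ => (0 : ℝ))]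
      · simp
      · intro τ hτ
        rw [uIcc_of_le hs.2] at hτ
        simp [hH, not_lt.2 hτ.1]
    rw [e1, add_zero]
    refine intervalIntegral.integral_congr_ae ?_
    filter_upwards [compl_mem_ae_iff.2 (measure_singleton s)] with τ hτ hτ'
    rw [uIoc_of_le hs.1] at hτ'
    have : τ < s := lt_of_le_of_ne hτ'.2 hτ
    simp [hH, this]
  have h2 : ∀ τ ∈ uIcc 0 t, ∫ s in τ..t, G s τ = ∫ s in (0 : ℝ)..t, H s τ := by
    intro τ hτ
    rw [uIcc_of_le ht] at hτ
    have hi := fun a b => intervalIntegrable_of_bounded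
      (hHm'.comp (measurable_prodMk_left (x := τ))) (fun y => hHb y τ) a b
    have := intervalIntegral.integral_add_adjacent_intervals (hi 0 τ) (hi τ t)
    simp only [Function.comp_def, Function.uncurry_apply_pair] at this
    rw [← this]
    have e1 : ∫ s in (0 : ℝ)..τ, H s τ = 0 := by
      rw [intervalIntegral.integral_congr (g := fun _ => (0 : ℝ))]
      · simp
      · intro s hs
        rw [uIcc_of_le hτ.1] at hs
        simp [hH, not_lt.2 hs.2]
    rw [e1, zero_add]
    refine intervalIntegral.integral_congr_ae (Eventually.of_forall fun s hs => ?_)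
    rw [uIoc_of_le hτ.2] at hs
    simp [hH, hs.1]
  constructor
  · refine (intervalIntegrable_intervalIntegral hHm' (fun x y => hHb y x) 0 t 0 t).congr ?_
    intro τ hτ
    exact (h2 τ (uIoc_subset_uIcc hτ)).symm
  · rw [intervalIntegral.integral_congr h1, intervalIntegral.integral_congr h2]
    exact intervalIntegral_swap_of_bounded hHm hHb 0 t 0 t

/-! ### Integrals along characteristics -/

/-- Bounded measurable functions of `(x, t)` that are continuous away from countably many
vertical and horizontal lines. Every characteristic line meets the exceptional set in a countable
set, which is what makes integrals along characteristics continuous. -/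
structure IsGridContinuous (f : ℝ → ℝ → ℝ) (M : ℝ) : Prop where
  measurable : Measurable f.uncurry
  bound : ∀ x t, |f x t| ≤ M
  continuousAt : ∃ S : Set ℝ, S.Countable ∧
    ∀ x t, x ∉ S → t ∉ S → ContinuousAt f.uncurry (x, t)

namespace IsGridContinuous

variable {f g : ℝ → ℝ → ℝ} {M M' : ℝ}

lemma of_continuous (hf : Continuous f.uncurry) (hM : ∀ x t, |f x t| ≤ M) :
    IsGridContinuous f M :=
  ⟨hf.measurable, hM, ∅, countable_empty, fun _ _ _ _ => hf.continuousAt⟩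

lemma nonneg (hf : IsGridContinuous f M) : 0 ≤ M := (abs_nonneg _).trans (hf.bound 0 0)

lemma mono (hf : IsGridContinuous f M) (h : M ≤ M') : IsGridContinuous f M' :=
  ⟨hf.measurable, fun x t => (hf.bound x t).trans h, hf.continuousAt⟩

lemma add (hf : IsGridContinuous f M) (hg : IsGridContinuous g M') :
    IsGridContinuous (fun x t => f x t + g x t) (M + M') := by
  obtain ⟨S, hS, hcS⟩ := hf.continuousAt
  obtain ⟨S', hS', hcS'⟩ := hg.continuousAt
  refine ⟨hf.measurable.add hg.measurable,
    fun x t => (abs_add_le _ _).trans (add_le_add (hf.bound x t) (hg.bound x t)),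
    S ∪ S', hS.union hS', fun x t hx ht => ?_⟩
  simp only [mem_union, not_or] at hx ht
  exact (hcS x t hx.1 ht.1).add (hcS' x t hx.2 ht.2)

lemma mul (hf : IsGridContinuous f M) (hg : IsGridContinuous g M') :
    IsGridContinuous (fun x t => f x t * g x t) (M * M') := by
  obtain ⟨S, hS, hcS⟩ := hf.continuousAt
  obtain ⟨S', hS', hcS'⟩ := hg.continuousAt
  refine ⟨hf.measurable.mul hg.measurable, fun x t => ?_,
    S ∪ S', hS.union hS', fun x t hx ht => ?_⟩
  · rw [abs_mul]
    exact mul_le_mul (hf.bound x t) (hg.bound x t) (abs_nonneg _) hf.nonneg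
  · simp only [mem_union, not_or] at hx ht
    exact (hcS x t hx.1 ht.1).mul (hcS' x t hx.2 ht.2)

lemma reflect (hf : IsGridContinuous f M) : IsGridContinuous (fun x t => f (-x) t) M := by
  obtain ⟨S, hS, hcS⟩ := hf.continuousAt
  refine ⟨hf.measurable.comp (measurable_fst.neg.prodMk measurable_snd),
    fun x t => hf.bound _ t, S ∪ Neg.neg '' S, hS.union (hS.image _), fun x t hx ht => ?_⟩
  simp only [mem_union, not_or] at hx ht
  have h : -x ∉ S := fun h => hx.2 ⟨-x, h, neg_neg x⟩
  exact ContinuousAt.comp (f := fun p : ℝ × ℝ => (-p.1, p.2)) (x := (x, t)) (hcS (-x) t h ht.1)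
    (by fun_prop)

end IsGridContinuous

/-- The integral of `f` along the right-moving characteristic from time `0` up to the point
`(x, t)`. -/
noncomputable def charIntegral (f : ℝ → ℝ → ℝ) (x t : ℝ) : ℝ :=
  ∫ r in (0 : ℝ)..t, f (x - r) (t - r)

section charIntegral

variable {f : ℝ → ℝ → ℝ} {M : ℝ}

lemma IsGridContinuous.measurable_char (hf : IsGridContinuous f M) :
    Measurable fun p : (ℝ × ℝ) × ℝ => f (p.1.1 - p.2) (p.1.2 - p.2) :=
  hf.measurable.comp ((measurable_fst.fst.sub measurable_snd).prodMk
    (measurable_fst.snd.sub measurable_snd))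

lemma IsGridContinuous.intervalIntegrable_char (hf : IsGridContinuous f M) (x t a b : ℝ) :
    IntervalIntegrable (fun r => f (x - r) (t - r)) volume a b :=
  intervalIntegrable_of_bounded (hf.measurable_char.comp (measurable_prodMk_left (x := (x, t))))
    (fun _ => hf.bound _ _) a b

lemma charIntegral_eq_of_le (hf : IsGridContinuous f M) (h0 : ∀ x t, t ≤ 0 → f x t = 0)
    {x t N : ℝ} (h : t ≤ N) : charIntegral f x t = ∫ r in (0 : ℝ)..N, f (x - r) (t - r) := by
  rw [charIntegral, ← intervalIntegral.integral_add_adjacent_intervals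
    (hf.intervalIntegrable_char x t 0 t) (hf.intervalIntegrable_char x t t N)]
  have : ∫ r in t..N, f (x - r) (t - r) = 0 := by
    rw [intervalIntegral.integral_congr (g := fun _ => (0 : ℝ))]
    · simp
    · intro r hr
      rw [uIcc_of_le h] at hr
      exact h0 _ _ (by linarith [hr.1])
  rw [this, add_zero]

lemma charIntegral_of_nonpos (h0 : ∀ x t, t ≤ 0 → f x t = 0) {x t : ℝ} (ht : t ≤ 0) :
    charIntegral f x t = 0 := by
  rw [charIntegral, intervalIntegral.integral_congr (g := fun _ => (0 : ℝ))]
  · simp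
  · intro r hr
    rw [uIcc_of_ge ht] at hr
    exact h0 _ _ (by linarith [hr.1])

lemma continuous_charIntegral (hf : IsGridContinuous f M) (h0 : ∀ x t, t ≤ 0 → f x t = 0) :
    Continuous (charIntegral f).uncurry := by
  rw [continuous_iff_continuousAt]
  rintro ⟨x, t⟩
  have hev : (charIntegral f).uncurry =ᶠ[𝓝 (x, t)]
      fun p => ∫ r in (0 : ℝ)..(t + 1), f (p.1 - r) (p.2 - r) := by
    have : ∀ᶠ p : ℝ × ℝ in 𝓝 (x, t), p.2 < t + 1 :=
      continuous_snd.continuousAt.eventually_lt continuousAt_const (by simp)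
    filter_upwards [this] with p hp
    exact charIntegral_eq_of_le hf h0 hp.le
  refine ContinuousAt.congr ?_ hev.symm
  refine intervalIntegral.continuousAt_of_dominated_interval (bound := fun _ => M)
    (Eventually.of_forall fun p => (hf.measurable_char.comp
      (measurable_prodMk_left (x := p))).aestronglyMeasurable)
    (Eventually.of_forall fun p => Eventually.of_forall fun r _ => hf.bound _ _)
    intervalIntegrable_const ?_
  obtain ⟨S, hS, hcS⟩ := hf.continuousAt
  have h1 : ((fun r => x - r) ⁻¹' S).Countable := hS.preimage (sub_right_injective)
  have h2 : ((fun r => t - r) ⁻¹' S).Countable := hS.preimage (sub_right_injective)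
  filter_upwards [h1.ae_notMem volume, h2.ae_notMem volume] with r hr1 hr2 _
  exact ContinuousAt.comp (f := fun p : ℝ × ℝ => (p.1 - r, p.2 - r)) (x := (x, t))
    (hcS _ _ hr1 hr2) (by fun_prop)

/-- The balance law, on the rectangle `(a, b) × (0, t)`, of the transport equation
`w_t + w_x = f` solved by `w = charIntegral f`. -/
lemma charIntegral_balance (hf : IsGridContinuous f M) (h0 : ∀ x t, t ≤ 0 → f x t = 0)
    (a b t : ℝ) :
    (∫ x in a..b, charIntegral f x t)
      + ((∫ s in (0 : ℝ)..t, charIntegral f b s) - ∫ s in (0 : ℝ)..t, charIntegral f a s)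
      = ∫ s in (0 : ℝ)..t, ∫ x in a..b, f x s := by
  have hzero : ∀ {g : ℝ → ℝ}, t ≤ 0 → (∀ s ≤ 0, g s = 0) → ∫ s in (0 : ℝ)..t, g s = 0 := by
    intro g ht hg
    rw [intervalIntegral.integral_congr (g := fun _ => (0 : ℝ))]
    · simp
    · intro s hs
      rw [uIcc_of_ge ht] at hs
      exact hg s hs.2
  rcases le_total t 0 with ht | ht
  · rw [hzero ht fun s hs => charIntegral_of_nonpos h0 hs,
      hzero ht fun s hs => charIntegral_of_nonpos h0 hs,
      hzero ht fun s hs => by simp [h0 _ s hs]]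
    simp [charIntegral_of_nonpos h0 ht]
  have hrev : ∀ x s, charIntegral f x s = ∫ τ in (0 : ℝ)..s, f (x - s + τ) τ := by
    intro x s
    have := intervalIntegral.integral_comp_sub_left (a := 0) (b := s)
      (fun τ => f (x - s + τ) τ) s
    simp only [sub_self, sub_zero] at this
    rw [← this, charIntegral]
    refine intervalIntegral.integral_congr fun r _ => ?_
    congr 1
    ring
  have hy : ∀ τ a b, IntervalIntegrable (fun y => f y τ) volume a b := fun τ a b =>
    intervalIntegrable_of_bounded (hf.measurable.comp (measurable_prodMk_right (y := τ)))
      (fun y => hf.bound y τ) a b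
  -- the first integral, over the slanted strip below the top side of the rectangle
  have hm1 : Measurable (fun x τ => f (x - t + τ) τ).uncurry :=
    hf.measurable.comp (((measurable_fst.sub_const t).add measurable_snd).prodMk measurable_snd)
  have hstrip : ∀ τ, ∫ x in a..b, f (x - t + τ) τ
      = ∫ y in (a - t + τ)..(b - t + τ), f y τ := by
    intro τ
    have := intervalIntegral.integral_comp_add_right (a := a) (b := b) (fun y => f y τ) (τ - t)
    rw [show a - t + τ = a + (τ - t) by ring, show b - t + τ = b + (τ - t) by ring, ← this]
    refine intervalIntegral.integral_congr fun x _ => ?_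
    congr 1
    ring
  have e1 : ∫ x in a..b, charIntegral f x t
      = ∫ τ in (0 : ℝ)..t, ∫ y in (a - t + τ)..(b - t + τ), f y τ := by
    simp_rw [hrev, ← hstrip]
    exact intervalIntegral_swap_of_bounded hm1 (fun _ _ => hf.bound _ _) _ _ _ _
  have i1 : IntervalIntegrable (fun τ => ∫ y in (a - t + τ)..(b - t + τ), f y τ) volume 0 t := by
    simp_rw [← hstrip]
    exact intervalIntegrable_intervalIntegral (F := fun τ x => f (x - t + τ) τ)
      (hm1.comp measurable_swap) (fun _ _ => hf.bound _ _) a b 0 t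
  -- the integrals over the triangles to the left of the vertical sides
  have hsub : ∀ c τ, ∫ s in τ..t, f (c - s + τ) τ = ∫ y in (c - t + τ)..c, f y τ := by
    intro c τ
    have := intervalIntegral.integral_comp_sub_left (a := τ) (b := t) (fun y => f y τ) (c + τ)
    rw [show c + τ - t = c - t + τ by ring, show c + τ - τ = c by ring] at this
    rw [← this]
    refine intervalIntegral.integral_congr fun x _ => ?_
    congr 1
    ring
  have e2 : ∀ c, IntervalIntegrable (fun τ => ∫ y in (c - t + τ)..c, f y τ) volume 0 t ∧
      ∫ s in (0 : ℝ)..t, charIntegral f c s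
        = ∫ τ in (0 : ℝ)..t, ∫ y in (c - t + τ)..c, f y τ := by
    intro c
    have hm2 : Measurable (fun s τ => f (c - s + τ) τ).uncurry :=
      hf.measurable.comp (((measurable_fst.const_sub c).add measurable_snd).prodMk measurable_snd)
    have := intervalIntegral_triangle_swap hm2 (fun _ _ => hf.bound _ _) ht
    simp_rw [hsub] at this
    refine ⟨this.1, ?_⟩
    simp_rw [hrev]
    exact this.2
  rw [e1, (e2 b).2, (e2 a).2, ← intervalIntegral.integral_sub (e2 b).1 (e2 a).1,
    ← intervalIntegral.integral_add i1 ((e2 b).1.sub (e2 a).1)]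
  refine intervalIntegral.integral_congr fun τ _ => ?_
  have k1 := intervalIntegral.integral_add_adjacent_intervals
    (hy τ (a - t + τ) (b - t + τ)) (hy τ (b - t + τ) b)
  have k2 := intervalIntegral.integral_add_adjacent_intervals
    (hy τ (a - t + τ) a) (hy τ a b)
  linarith

/-- Along characteristics, exponential growth in time integrates to exponential growth. -/
lemma abs_intervalIntegral_le_exp {g : ℝ → ℝ} {B lam t : ℝ} (hB : 0 ≤ B) (hlam : 0 < lam)
    (ht : 0 ≤ t) (hg : ∀ s ∈ Icc 0 t, |g s| ≤ B * Real.exp (lam * s)) :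
    |∫ s in (0 : ℝ)..t, g s| ≤ B / lam * Real.exp (lam * t) := by
  have h1 : ‖∫ s in (0 : ℝ)..t, g s‖ ≤ ∫ s in (0 : ℝ)..t, B * Real.exp (lam * s) :=
    intervalIntegral.norm_integral_le_of_norm_le ht
      (Eventually.of_forall fun s hs => hg s (Ioc_subset_Icc_self hs))
      (by apply Continuous.intervalIntegrable; fun_prop)
  have h2 : ∫ s in (0 : ℝ)..t, B * Real.exp (lam * s)
      = B / lam * Real.exp (lam * t) - B / lam * Real.exp (lam * 0) := by
    refine intervalIntegral.integral_eq_sub_of_hasDerivAt (f := fun s => B / lam * Real.exp (lam * s))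
      (fun s _ => ?_) (by apply Continuous.intervalIntegrable; fun_prop)
    have := (((hasDerivAt_id s).const_mul lam).exp).const_mul (B / lam)
    refine this.congr_deriv ?_
    simp only [id, mul_one]
    field_simp
  rw [Real.norm_eq_abs, h2] at h1
  have : 0 ≤ B / lam * Real.exp (lam * 0) := by positivity
  linarith

lemma abs_charIntegral_le_exp {B lam N x t : ℝ} (hB : 0 ≤ B) (hlam : 0 < lam) (ht : 0 ≤ t)
    (htN : t ≤ N) (hg : ∀ x, ∀ s ∈ Icc 0 N, |f x s| ≤ B * Real.exp (lam * s)) :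
    |charIntegral f x t| ≤ B / lam * Real.exp (lam * t) := by
  have : charIntegral f x t = ∫ s in (0 : ℝ)..t, f (x - t + s) s := by
    have := intervalIntegral.integral_comp_sub_left (a := 0) (b := t)
      (fun τ => f (x - t + τ) τ) t
    simp only [sub_self, sub_zero] at this
    rw [← this, charIntegral]
    refine intervalIntegral.integral_congr fun r _ => ?_
    congr 1
    ring
  rw [this]
  exact abs_intervalIntegral_le_exp hB hlam ht fun s hs => hg _ s ⟨hs.1, hs.2.trans htN⟩

lemma abs_charIntegral_le {B x t : ℝ} (hg : ∀ x s, |f x s| ≤ B) :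
    |charIntegral f x t| ≤ B * |t| := by
  simpa [charIntegral] using abs_intervalIntegral_le (a := 0) (b := t) fun r => hg (x - r) (t - r)

end charIntegral

/-! ### Continuously differentiable solutions of the wave equation with a source -/

/-- `R` is a continuously differentiable solution, with partial derivatives `Rx` and `Rt`, of
`R_tt - R_xx = f` on the whole plane. The derivatives and the equation are stated in integrated
form; `flux` is the balance law on rectangles, which makes sense for a discontinuous `f`. -/
structure C1Wave (R Rx Rt f : ℝ → ℝ → ℝ) : Prop where
  continuous_x : Continuous Rx.uncurry
  continuous_t : Continuous Rt.uncurry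
  measurable : Measurable f.uncurry
  bounded : ∃ M, ∀ x t, |f x t| ≤ M
  time : ∀ x c d, R x d - R x c = ∫ s in c..d, Rt x s
  space : ∀ t a b, R b t - R a t = ∫ x in a..b, Rx x t
  flux : ∀ a b c d, (∫ x in a..b, Rt x d) - (∫ x in a..b, Rt x c)
    = (∫ s in c..d, Rx b s) - (∫ s in c..d, Rx a s) + ∫ s in c..d, ∫ x in a..b, f x s

/-- The integral of `f` along the left-moving characteristic from time `0` up to `(x, t)`. -/
noncomputable def charIntegralLeft (f : ℝ → ℝ → ℝ) (x t : ℝ) : ℝ :=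
  charIntegral (fun y s => f (-y) s) (-x) t

/-- Duhamel's solution of `R_tt - R_xx = f` with zero data at `t = 0`, for `f` vanishing for
negative times. -/
noncomputable def duhamel (f : ℝ → ℝ → ℝ) (x t : ℝ) : ℝ :=
  ∫ s in (0 : ℝ)..t, (charIntegralLeft f x s + charIntegral f x s) / 2

section duhamel

variable {f g : ℝ → ℝ → ℝ} {M M' : ℝ}

lemma continuous_charIntegralLeft (hf : IsGridContinuous f M) (h0 : ∀ x t, t ≤ 0 → f x t = 0) :
    Continuous (charIntegralLeft f).uncurry :=
  (continuous_charIntegral hf.reflect fun _ t ht => h0 _ t ht).comp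
    (continuous_fst.neg.prodMk continuous_snd)

lemma charIntegralLeft_balance (hf : IsGridContinuous f M) (h0 : ∀ x t, t ≤ 0 → f x t = 0)
    (a b t : ℝ) :
    (∫ x in a..b, charIntegralLeft f x t)
      - ((∫ s in (0 : ℝ)..t, charIntegralLeft f b s) - ∫ s in (0 : ℝ)..t, charIntegralLeft f a s)
      = ∫ s in (0 : ℝ)..t, ∫ x in a..b, f x s := by
  have h := charIntegral_balance hf.reflect (fun x t ht => h0 _ t ht) (-b) (-a) t
  have e1 := intervalIntegral.integral_comp_neg (a := a) (b := b)
    (fun x => charIntegral (fun y s => f (-y) s) x t)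
  have e2 : ∀ s, ∫ x in (-b)..(-a), f (-x) s = ∫ x in a..b, f x s := by
    intro s
    simpa using intervalIntegral.integral_comp_neg (a := -b) (b := -a) (fun x => f x s)
  simp_rw [e2] at h
  rw [← e1] at h
  rw [← h]
  simp only [charIntegralLeft]
  ring

theorem c1Wave_duhamel (hf : IsGridContinuous f M) (h0 : ∀ x t, t ≤ 0 → f x t = 0) :
    C1Wave (duhamel f) (fun x t => (charIntegralLeft f x t - charIntegral f x t) / 2)
      (fun x t => (charIntegralLeft f x t + charIntegral f x t) / 2) f := by
  have cl := continuous_charIntegralLeft hf h0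
  have cr := continuous_charIntegral hf h0
  have clx : ∀ t, Continuous fun x => charIntegralLeft f x t := fun t =>
    cl.comp (continuous_id.prodMk continuous_const)
  have crx : ∀ t, Continuous fun x => charIntegral f x t := fun t =>
    cr.comp (continuous_id.prodMk continuous_const)
  have clt : ∀ x, Continuous fun t => charIntegralLeft f x t := fun x =>
    cl.comp (continuous_const.prodMk continuous_id)
  have crt : ∀ x, Continuous fun t => charIntegral f x t := fun x =>
    cr.comp (continuous_const.prodMk continuous_id)
  have il : ∀ t a b, IntervalIntegrable (fun x => charIntegralLeft f x t) volume a b :=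
    fun t a b => (clx t).intervalIntegrable a b
  have ir : ∀ t a b, IntervalIntegrable (fun x => charIntegral f x t) volume a b :=
    fun t a b => (crx t).intervalIntegrable a b
  have jl : ∀ t a b, IntervalIntegrable (fun x => charIntegralLeft f t x) volume a b :=
    fun t a b => (clt t).intervalIntegrable a b
  have jr : ∀ t a b, IntervalIntegrable (fun x => charIntegral f t x) volume a b :=
    fun t a b => (crt t).intervalIntegrable a b
  have hN : ∀ a b c d, IntervalIntegrable (fun s => ∫ x in a..b, f x s) volume c d :=
    fun a b c d => intervalIntegrable_intervalIntegral (F := fun s x => f x s)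
      (hf.measurable.comp measurable_swap) (fun _ _ => hf.bound _ _) a b c d
  refine ⟨?_, ?_, hf.measurable, ⟨M, hf.bound⟩, ?_, ?_, ?_⟩
  · exact (cl.sub cr).div_const 2
  · exact (cl.add cr).div_const 2
  · intro x c d
    unfold duhamel
    have hi : ∀ c d, IntervalIntegrable
        (fun s => (charIntegralLeft f x s + charIntegral f x s) / 2) volume c d :=
      fun c d => ((jl x c d).add (jr x c d)).div_const 2
    rw [← intervalIntegral.integral_add_adjacent_intervals (hi 0 c) (hi c d)]
    ring
  · intro t a b
    have hl := charIntegralLeft_balance hf h0 a b t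
    have hr := charIntegral_balance hf h0 a b t
    simp only [duhamel, intervalIntegral.integral_div]
    rw [intervalIntegral.integral_add (jl _ _ _) (jr _ _ _),
      intervalIntegral.integral_add (jl _ _ _) (jr _ _ _),
      intervalIntegral.integral_sub (il _ _ _) (ir _ _ _)]
    linarith
  · intro a b c d
    simp only [intervalIntegral.integral_div]
    rw [intervalIntegral.integral_add (il _ _ _) (ir _ _ _),
      intervalIntegral.integral_add (il _ _ _) (ir _ _ _),
      intervalIntegral.integral_sub (jl _ _ _) (jr _ _ _),
      intervalIntegral.integral_sub (jl _ _ _) (jr _ _ _)]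
    have hl := charIntegralLeft_balance hf h0 a b d
    have hr := charIntegral_balance hf h0 a b d
    have hl' := charIntegralLeft_balance hf h0 a b c
    have hr' := charIntegral_balance hf h0 a b c
    have k1 := intervalIntegral.integral_add_adjacent_intervals (jl a 0 c) (jl a c d)
    have k2 := intervalIntegral.integral_add_adjacent_intervals (jl b 0 c) (jl b c d)
    have k3 := intervalIntegral.integral_add_adjacent_intervals (jr a 0 c) (jr a c d)
    have k4 := intervalIntegral.integral_add_adjacent_intervals (jr b 0 c) (jr b c d)
    have k5 := intervalIntegral.integral_add_adjacent_intervals (hN a b 0 c) (hN a b c d)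
    linarith

lemma charIntegral_sub (hf : IsGridContinuous f M) (hg : IsGridContinuous g M') (x t : ℝ) :
    charIntegral (fun x t => f x t - g x t) x t = charIntegral f x t - charIntegral g x t :=
  intervalIntegral.integral_sub (hf.intervalIntegrable_char _ _ _ _)
    (hg.intervalIntegrable_char _ _ _ _)

lemma duhamel_sub (hf : IsGridContinuous f M) (h0 : ∀ x t, t ≤ 0 → f x t = 0)
    (hg : IsGridContinuous g M') (h0' : ∀ x t, t ≤ 0 → g x t = 0) (x t : ℝ) :
    duhamel (fun x t => f x t - g x t) x t = duhamel f x t - duhamel g x t := by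
  have cl : ∀ {f M}, IsGridContinuous f M → (∀ x t, t ≤ 0 → f x t = 0) →
      IntervalIntegrable (fun s => (charIntegralLeft f x s + charIntegral f x s) / 2)
        volume 0 t := fun hf h0 =>
    (((c1Wave_duhamel hf h0).continuous_t.comp
      (continuous_const.prodMk continuous_id)).intervalIntegrable (μ := volume) 0 t)
  unfold duhamel
  rw [← intervalIntegral.integral_sub (cl hf h0) (cl hg h0')]
  refine intervalIntegral.integral_congr fun s _ => ?_
  simp only [charIntegralLeft]
  rw [charIntegral_sub hf hg, charIntegral_sub hf.reflect hg.reflect]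
  ring

lemma duhamel_of_nonpos (h0 : ∀ x t, t ≤ 0 → f x t = 0) {x t : ℝ} (ht : t ≤ 0) :
    duhamel f x t = 0 := by
  rw [duhamel, intervalIntegral.integral_congr (g := fun _ => (0 : ℝ))]
  · simp
  · intro s hs
    rw [uIcc_of_ge ht] at hs
    simp [charIntegralLeft, charIntegral_of_nonpos h0 hs.2,
      charIntegral_of_nonpos (f := fun y s => f (-y) s) (fun x t ht => h0 _ t ht) hs.2]

lemma abs_duhamel_le_exp {B lam N x t : ℝ} (hB : 0 ≤ B) (hlam : 0 < lam) (ht : 0 ≤ t)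
    (htN : t ≤ N) (hg : ∀ x, ∀ s ∈ Icc 0 N, |f x s| ≤ B * Real.exp (lam * s)) :
    |duhamel f x t| ≤ B / lam / lam * Real.exp (lam * t) := by
  refine abs_intervalIntegral_le_exp (by positivity) hlam ht fun s hs => ?_
  have h1 := abs_charIntegral_le_exp (x := x) hB hlam hs.1 (hs.2.trans htN) hg
  have h2 := abs_charIntegral_le_exp (x := -x) (f := fun y s => f (-y) s) hB hlam hs.1
    (hs.2.trans htN) (fun x => hg (-x))
  rw [charIntegralLeft, abs_le]
  rw [abs_le] at h1 h2
  constructor <;> linarith [h1.1, h1.2, h2.1, h2.2]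

/-- A source that is odd about `c` produces a wave that is odd about `c`. -/
lemma duhamel_odd {c : ℝ} (h : ∀ x t, f (2 * c - x) t = -f x t) (x t : ℝ) :
    duhamel f (2 * c - x) t = -duhamel f x t := by
  have h1 : ∀ x s, charIntegral f (2 * c - x) s = -charIntegralLeft f x s := by
    intro x s
    rw [charIntegralLeft, charIntegral, charIntegral, ← intervalIntegral.integral_neg]
    refine intervalIntegral.integral_congr fun r _ => ?_
    rw [← h]
    congr 1
    ring
  have h2 : ∀ s, charIntegralLeft f (2 * c - x) s = -charIntegral f x s := by
    intro s
    have := h1 (2 * c - x) s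
    rw [show 2 * c - (2 * c - x) = x by ring] at this
    linarith
  rw [duhamel, duhamel, ← intervalIntegral.integral_neg]
  refine intervalIntegral.integral_congr fun s _ => ?_
  rw [h1, h2]
  ring

/-- Finite speed of propagation: a source supported in the cone `|x| < t` produces a wave
supported in that cone. -/
lemma duhamel_cone (h : ∀ x t, t ≤ |x| → f x t = 0) {x t : ℝ} (ht : t ≤ |x|) :
    duhamel f x t = 0 := by
  have h0 : ∀ x t, t ≤ 0 → f x t = 0 := fun x t ht => h x t (ht.trans (abs_nonneg x))
  rcases le_total t 0 with ht0 | ht0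
  · exact duhamel_of_nonpos h0 ht0
  have key : ∀ {f : ℝ → ℝ → ℝ}, (∀ x t, t ≤ |x| → f x t = 0) → ∀ x s, 0 ≤ s → s ≤ |x| →
      charIntegral f x s = 0 := by
    intro f h x s hs0 hs
    rw [charIntegral, intervalIntegral.integral_congr (g := fun _ => (0 : ℝ))]
    · simp
    · intro r hr
      rw [uIcc_of_le hs0] at hr
      refine h _ _ ?_
      have := abs_sub_abs_le_abs_sub x r
      rw [abs_of_nonneg hr.1] at this
      linarith
  rw [duhamel, intervalIntegral.integral_congr (g := fun _ => (0 : ℝ))]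
  · simp
  · intro s hs
    rw [uIcc_of_le ht0] at hs
    simp only [charIntegralLeft]
    rw [key h x s hs.1 (hs.2.trans ht), key (f := fun y s => f (-y) s)
      (fun x t ht => h _ t (by rwa [abs_neg])) (-x) s hs.1 (by rw [abs_neg]; exact hs.2.trans ht)]
    simp

end duhamel

namespace C1Wave

variable {R Rx Rt f : ℝ → ℝ → ℝ}

lemma continuous_x_left (h : C1Wave R Rx Rt f) (t : ℝ) : Continuous fun x => Rx x t :=
  h.continuous_x.comp (continuous_id.prodMk continuous_const)

lemma continuous_x_right (h : C1Wave R Rx Rt f) (x : ℝ) : Continuous fun t => Rx x t :=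
  h.continuous_x.comp (continuous_const.prodMk continuous_id)

lemma continuous_t_left (h : C1Wave R Rx Rt f) (t : ℝ) : Continuous fun x => Rt x t :=
  h.continuous_t.comp (continuous_id.prodMk continuous_const)

lemma continuous_t_right (h : C1Wave R Rx Rt f) (x : ℝ) : Continuous fun t => Rt x t :=
  h.continuous_t.comp (continuous_const.prodMk continuous_id)

lemma hasDerivAt_x (h : C1Wave R Rx Rt f) (x t : ℝ) :
    HasDerivAt (fun x => R x t) (Rx x t) x := by
  have h1 : (fun y => R y t) = fun y => R x t + ∫ z in x..y, Rx z t := by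
    ext y
    rw [← h.space]
    ring
  rw [h1]
  exact (((h.continuous_x_left t).integral_hasStrictDerivAt x x).hasDerivAt).const_add _

lemma hasDerivAt_t (h : C1Wave R Rx Rt f) (x t : ℝ) :
    HasDerivAt (fun t => R x t) (Rt x t) t := by
  have h1 : (fun y => R x y) = fun y => R x t + ∫ z in t..y, Rt x z := by
    ext y
    rw [← h.time]
    ring
  rw [h1]
  exact (((h.continuous_t_right x).integral_hasStrictDerivAt t t).hasDerivAt).const_add _

lemma continuous (h : C1Wave R Rx Rt f) : Continuous R.uncurry := by
  have h1 : R.uncurry = fun p : ℝ × ℝ => R 0 0 + (∫ s in (0 : ℝ)..p.2, Rt 0 s)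
      + ∫ x in (0 : ℝ)..p.1, Rx x p.2 := by
    ext ⟨x, t⟩
    rw [← h.time, ← h.space]
    simp
  rw [h1]
  refine (continuous_const.add ?_).add ?_
  · exact (intervalIntegral.continuous_primitive
      (fun a b => (h.continuous_t_right 0).intervalIntegrable a b) 0).comp continuous_snd
  · refine intervalIntegral.continuous_parametric_intervalIntegral_of_continuous
      (f := fun (p : ℝ × ℝ) x => Rx x p.2) ?_ continuous_fst
    exact h.continuous_x.comp (continuous_snd.prodMk continuous_fst.snd)

lemma integrable_source (h : C1Wave R Rx Rt f) (a b c d : ℝ) :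
    IntervalIntegrable (fun s => ∫ x in a..b, f x s) volume c d := by
  obtain ⟨M, hM⟩ := h.bounded
  exact intervalIntegrable_intervalIntegral (F := fun s x => f x s)
    (h.measurable.comp measurable_swap) (fun s x => hM x s) a b c d

lemma add {R' Rx' Rt' f' : ℝ → ℝ → ℝ} (h : C1Wave R Rx Rt f) (h' : C1Wave R' Rx' Rt' f') :
    C1Wave (fun x t => R x t + R' x t) (fun x t => Rx x t + Rx' x t)
      (fun x t => Rt x t + Rt' x t) (fun x t => f x t + f' x t) := by
  obtain ⟨M, hM⟩ := h.bounded
  obtain ⟨M', hM'⟩ := h'.bounded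
  refine ⟨h.continuous_x.add h'.continuous_x, h.continuous_t.add h'.continuous_t,
    h.measurable.add h'.measurable,
    ⟨M + M', fun x t => (abs_add_le _ _).trans (add_le_add (hM x t) (hM' x t))⟩, ?_, ?_, ?_⟩
  · intro x c d
    rw [intervalIntegral.integral_add ((h.continuous_t_right x).intervalIntegrable c d)
      ((h'.continuous_t_right x).intervalIntegrable c d), ← h.time, ← h'.time]
    ring
  · intro t a b
    rw [intervalIntegral.integral_add ((h.continuous_x_left t).intervalIntegrable a b)
      ((h'.continuous_x_left t).intervalIntegrable a b), ← h.space, ← h'.space]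
    ring
  · intro a b c d
    have hs : ∀ s, ∫ x in a..b, (f x s + f' x s) = (∫ x in a..b, f x s) + ∫ x in a..b, f' x s :=
      fun s => intervalIntegral.integral_add
        (intervalIntegrable_of_bounded (h.measurable.comp (measurable_prodMk_right (y := s)))
          (fun x => hM x s) a b)
        (intervalIntegrable_of_bounded (h'.measurable.comp (measurable_prodMk_right (y := s)))
          (fun x => hM' x s) a b)
    simp_rw [hs]
    rw [intervalIntegral.integral_add (h.integrable_source a b c d)
      (h'.integrable_source a b c d)]
    have i1 := fun t => intervalIntegral.integral_add
      ((h.continuous_t_left t).intervalIntegrable (μ := volume) a b)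
      ((h'.continuous_t_left t).intervalIntegrable a b)
    have i2 := fun x => intervalIntegral.integral_add
      ((h.continuous_x_right x).intervalIntegrable (μ := volume) c d)
      ((h'.continuous_x_right x).intervalIntegrable c d)
    rw [i1, i1, i2, i2]
    linarith [h.flux a b c d, h'.flux a b c d]

lemma neg (h : C1Wave R Rx Rt f) :
    C1Wave (fun x t => -R x t) (fun x t => -Rx x t) (fun x t => -Rt x t)
      (fun x t => -f x t) := by
  obtain ⟨M, hM⟩ := h.bounded
  refine ⟨h.continuous_x.neg, h.continuous_t.neg, h.measurable.neg,
    ⟨M, fun x t => by simpa using hM x t⟩, ?_, ?_, ?_⟩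
  · intro x c d
    rw [intervalIntegral.integral_neg, ← h.time]
    ring
  · intro t a b
    rw [intervalIntegral.integral_neg, ← h.space]
    ring
  · intro a b c d
    simp only [intervalIntegral.integral_neg]
    linarith [h.flux a b c d]

lemma reflect (h : C1Wave R Rx Rt f) :
    C1Wave (fun x t => R (-x) t) (fun x t => -Rx (-x) t) (fun x t => Rt (-x) t)
      (fun x t => f (-x) t) := by
  obtain ⟨M, hM⟩ := h.bounded
  have hc : Continuous fun p : ℝ × ℝ => (-p.1, p.2) := by fun_prop
  refine ⟨(h.continuous_x.comp hc).neg, h.continuous_t.comp hc, h.measurable.comp hc.measurable,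
    ⟨M, fun x t => hM _ t⟩, ?_, ?_, ?_⟩
  · intro x c d
    exact h.time _ c d
  · intro t a b
    rw [intervalIntegral.integral_neg,
      intervalIntegral.integral_comp_neg (fun x => Rx x t), ← h.space]
    ring
  · intro a b c d
    have e := h.flux (-b) (-a) c d
    simp only [intervalIntegral.integral_neg]
    rw [intervalIntegral.integral_comp_neg (fun x => Rt x d),
      intervalIntegral.integral_comp_neg (fun x => Rt x c)]
    have : ∀ s, ∫ x in a..b, f (-x) s = ∫ x in (-b)..(-a), f x s :=
      fun s => intervalIntegral.integral_comp_neg (fun x => f x s)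
    simp_rw [this]
    linarith

lemma timeShift (h : C1Wave R Rx Rt f) (τ : ℝ) :
    C1Wave (fun x t => R x (t - τ)) (fun x t => Rx x (t - τ)) (fun x t => Rt x (t - τ))
      (fun x t => f x (t - τ)) := by
  obtain ⟨M, hM⟩ := h.bounded
  have hc : Continuous fun p : ℝ × ℝ => (p.1, p.2 - τ) := by fun_prop
  refine ⟨h.continuous_x.comp hc, h.continuous_t.comp hc, h.measurable.comp hc.measurable,
    ⟨M, fun x t => hM _ _⟩, ?_, ?_, ?_⟩
  · intro x c d
    rw [intervalIntegral.integral_comp_sub_right (fun s => Rt x s), ← h.time]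
  · intro t a b
    exact h.space _ a b
  · intro a b c d
    have e := h.flux a b (c - τ) (d - τ)
    rw [intervalIntegral.integral_comp_sub_right (fun s => Rx a s),
      intervalIntegral.integral_comp_sub_right (fun s => Rx b s),
      intervalIntegral.integral_comp_sub_right (fun s => ∫ x in a..b, f x s)]
    exact e

/-- The wave equation is invariant under exchanging space and time, up to the sign of the
source. -/
lemma swap (h : C1Wave R Rx Rt f) (T b : ℝ) :
    C1Wave (fun x t => R (T - t) (b - x)) (fun x t => -Rt (T - t) (b - x))
      (fun x t => -Rx (T - t) (b - x)) (fun x t => -f (T - t) (b - x)) := by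
  obtain ⟨M, hM⟩ := h.bounded
  have hc : Continuous fun p : ℝ × ℝ => (T - p.2, b - p.1) := by fun_prop
  have hm : Measurable (fun x t => f (T - t) (b - x)).uncurry := h.measurable.comp hc.measurable
  refine ⟨(h.continuous_t.comp hc).neg, (h.continuous_x.comp hc).neg, hm.neg,
    ⟨M, fun x t => by simpa using hM _ _⟩, ?_, ?_, ?_⟩
  · intro x c d
    rw [intervalIntegral.integral_neg,
      intervalIntegral.integral_comp_sub_left (fun s => Rx s (b - x)), ← h.space]
    ring
  · intro t a a'
    rw [intervalIntegral.integral_neg,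
      intervalIntegral.integral_comp_sub_left (fun s => Rt (T - t) s), ← h.time]
    ring
  · intro a a' c d
    have e := h.flux (T - d) (T - c) (b - a') (b - a)
    simp only [intervalIntegral.integral_neg]
    rw [intervalIntegral.integral_comp_sub_left (fun s => Rx (T - d) s),
      intervalIntegral.integral_comp_sub_left (fun s => Rx (T - c) s),
      intervalIntegral.integral_comp_sub_left (fun s => Rt s (b - a')),
      intervalIntegral.integral_comp_sub_left (fun s => Rt s (b - a))]
    have k : ∫ s in c..d, ∫ x in a..a', f (T - s) (b - x)
        = ∫ s in (b - a')..(b - a), ∫ x in (T - d)..(T - c), f x s := by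
      have k1 : ∀ x, ∫ s in c..d, f (T - s) (b - x) = ∫ s in (T - d)..(T - c), f s (b - x) :=
        fun x => intervalIntegral.integral_comp_sub_left (fun s => f s (b - x)) T
      rw [intervalIntegral_swap_of_bounded (F := fun s x => f (T - s) (b - x))
        (hm.comp measurable_swap) (fun _ _ => hM _ _)]
      simp_rw [k1]
      exact intervalIntegral.integral_comp_sub_left
        (fun s => ∫ x in (T - d)..(T - c), f x s) b
    rw [k]
    linarith

/-- A wave that is zero on `[0, l]` for `t ≤ 0` has zero derivatives there. -/
lemma deriv_eq_zero (h : C1Wave R Rx Rt f) {l : ℝ} (hl : 0 < l)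
    (h0 : ∀ x ∈ Icc 0 l, ∀ t ≤ 0, R x t = 0) {x t : ℝ} (hx : x ∈ Icc 0 l) (ht : t ≤ 0) :
    Rx x t = 0 ∧ Rt x t = 0 := by
  constructor
  · have h1 : HasDerivWithinAt (fun y => R y t) 0 (Icc 0 l) x :=
      (hasDerivWithinAt_const x (Icc 0 l) (0 : ℝ)).congr (fun y hy => h0 y hy t ht) (h0 x hx t ht)
    exact ((uniqueDiffOn_Icc hl) x hx).eq_deriv _ (h.hasDerivAt_x x t).hasDerivWithinAt h1
  · have h1 : HasDerivWithinAt (fun s => R x s) 0 (Iic t) t :=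
      (hasDerivWithinAt_const t (Iic t) (0 : ℝ)).congr
        (fun s hs => h0 x hx s (le_trans hs ht)) (h0 x hx t ht)
    exact (uniqueDiffWithinAt_Iic t).eq_deriv _ (h.hasDerivAt_t x t).hasDerivWithinAt h1

end C1Wave

/-! ### A Volterra equation for waves with a potential -/

/-- The scattered wave `R` of an incident, possibly discontinuous, wave `W`: it solves
`R_tt - R_xx = k (W + R)` up to time `N` with zero data at `t = 0`, and is controlled by the
supremum of `W`. It is found by Banach's fixed point theorem in a sup norm that is weighted
exponentially in time. Oddness and support in the cone `|x| < t` are closed conditions that the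
iteration preserves. -/
theorem exists_volterra_wave {k : ℝ → ℝ → ℝ} {K N : ℝ} (hk : IsGridContinuous k K)
    (hk0 : ∀ x t, t ≤ 0 → k x t = 0) (hN : 0 ≤ N) :
    ∃ C, 0 ≤ C ∧ ∀ (W : ℝ → ℝ → ℝ) (A : ℝ), IsGridContinuous W A →
      ∃ R Rx Rt f : ℝ → ℝ → ℝ, C1Wave R Rx Rt f ∧
        (∀ x t, t ≤ 0 → R x t = 0) ∧
        (∀ x t, t ≤ N → f x t = k x t * (W x t + R x t)) ∧
        (∀ x t, t ≤ N → |R x t| ≤ C * A ∧ |Rx x t| ≤ C * A ∧ |Rt x t| ≤ C * A) ∧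
        (∀ c, (∀ x t, k (2 * c - x) t = k x t) → (∀ x t, W (2 * c - x) t = -W x t) →
          ∀ x t, R (2 * c - x) t = -R x t) ∧
        ((∀ x t, t ≤ |x| → W x t = 0) → ∀ x t, t ≤ |x| → R x t = 0) := by
  have hK := hk.nonneg
  -- this rate makes the Volterra operator, of norm at most `K / lam ^ 2`, a contraction by `1 / 2`
  set lam : ℝ := K + 2 with hlam
  have hlam0 : 0 < lam := by positivity
  have hKlam : K / lam / lam ≤ 1 / 2 := by
    rw [div_div, div_le_iff₀ (by positivity), hlam]
    nlinarith
  set E := Real.exp (lam * N) with hE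
  have hE0 : 0 < E := Real.exp_pos _
  refine ⟨E + K * (1 + E) * N, by positivity, fun W A hW => ?_⟩
  have hA := hW.nonneg
  -- the weight is the exponential of the time, frozen outside `[0, N]`
  set m : ℝ → ℝ := fun t => max 0 (min t N) with hm
  have hmc : Continuous m := by fun_prop
  have hm0 : ∀ t, 0 ≤ m t := fun t => le_max_left _ _
  have hmN : ∀ t, m t ≤ N := fun t => max_le hN (min_le_right _ _)
  have hmt : ∀ t ∈ Icc 0 N, m t = t := fun t ht => by
    simp only [hm, min_eq_left ht.2, max_eq_right ht.1]
  -- the source, for the iterate that is `b` times the weight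
  let src : BoundedContinuousFunction (ℝ × ℝ) ℝ → ℝ → ℝ → ℝ :=
    fun b x t => k x t * (W x t + Real.exp (lam * m t) * b (x, t))
  have hsrc0 : ∀ b x t, t ≤ 0 → src b x t = 0 := fun b x t ht => by simp [src, hk0 x t ht]
  have hsrc : ∀ b, IsGridContinuous (src b) (K * (A + E * ‖b‖)) := by
    intro b
    refine hk.mul (hW.add (IsGridContinuous.of_continuous ?_ fun x t => ?_))
    · exact (Continuous.rexp (continuous_const.mul (hmc.comp continuous_snd))).mul b.continuous
    · rw [abs_mul, abs_of_pos (Real.exp_pos _)]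
      refine mul_le_mul ?_ (b.norm_coe_le_norm (x, t)) (abs_nonneg _) hE0.le
      exact Real.exp_le_exp.2 (mul_le_mul_of_nonneg_left (hmN t) hlam0.le)
  have hdc : ∀ b, Continuous (duhamel (src b)).uncurry :=
    fun b => (c1Wave_duhamel (hsrc b) (hsrc0 b)).continuous
  have hexp1 : ∀ s ∈ Icc 0 N, 1 ≤ Real.exp (lam * s) := fun s hs =>
    Real.one_le_exp (mul_nonneg hlam0.le hs.1)
  -- the weighted Volterra operator
  have hΦb : ∀ b (p : ℝ × ℝ), ∀ B, 0 ≤ B →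
      (∀ x, ∀ s ∈ Icc 0 N, |src b x s| ≤ B * Real.exp (lam * s)) →
      ‖Real.exp (-(lam * m p.2)) * duhamel (src b) p.1 (m p.2)‖ ≤ B / lam / lam := by
    intro b p B hB h
    rw [norm_mul, Real.norm_eq_abs, Real.norm_eq_abs, abs_of_pos (Real.exp_pos _), Real.exp_neg,
      inv_mul_le_iff₀ (Real.exp_pos _), mul_comm (Real.exp _)]
    exact abs_duhamel_le_exp hB hlam0 (hm0 _) (hmN _) h
  let Φ : BoundedContinuousFunction (ℝ × ℝ) ℝ → BoundedContinuousFunction (ℝ × ℝ) ℝ := fun b =>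
    BoundedContinuousFunction.ofNormedAddCommGroup
      (fun p => Real.exp (-(lam * m p.2)) * duhamel (src b) p.1 (m p.2))
      ((Continuous.rexp (continuous_const.mul (hmc.comp continuous_snd)).neg).mul
        ((hdc b).comp (continuous_fst.prodMk (hmc.comp continuous_snd))))
      (K * (A + E * ‖b‖) / lam / lam)
      (fun p => hΦb b p _ (hsrc b).nonneg fun x s hs =>
        ((hsrc b).bound x s).trans (le_mul_of_one_le_right (hsrc b).nonneg (hexp1 s hs)))
  have hΦ : ∀ b p, Φ b p = Real.exp (-(lam * m p.2)) * duhamel (src b) p.1 (m p.2) :=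
    fun b p => rfl
  have hcontr : ContractingWith (1 / 2) Φ := by
    refine ⟨by rw [← NNReal.coe_lt_coe]; norm_num, LipschitzWith.of_dist_le_mul fun b b' => ?_⟩
    rw [dist_eq_norm, dist_eq_norm]
    refine (BoundedContinuousFunction.norm_le (by positivity)).2 fun p => ?_
    rw [BoundedContinuousFunction.sub_apply, hΦ, hΦ, ← mul_sub,
      ← duhamel_sub (hsrc b) (hsrc0 b) (hsrc b') (hsrc0 b'), norm_mul, Real.norm_eq_abs,
      Real.norm_eq_abs, abs_of_pos (Real.exp_pos _), Real.exp_neg,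
      inv_mul_le_iff₀ (Real.exp_pos _), mul_comm (Real.exp _)]
    refine (abs_duhamel_le_exp (B := K * ‖b - b'‖) (by positivity) hlam0 (hm0 _) (hmN _)
      fun x s hs => ?_).trans (mul_le_mul_of_nonneg_right ?_ (Real.exp_pos _).le)
    · have : src b x s - src b' x s = k x s * ((b - b') (x, s)) * Real.exp (lam * s) := by
        simp only [src, hmt s hs, BoundedContinuousFunction.sub_apply]
        ring
      rw [this, abs_mul, abs_mul, abs_of_pos (Real.exp_pos (lam * s))]
      refine mul_le_mul_of_nonneg_right ?_ (Real.exp_pos _).le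
      exact mul_le_mul (hk.bound x s) ((b - b').norm_coe_le_norm (x, s)) (abs_nonneg _) hK
    · calc K * ‖b - b'‖ / lam / lam = K / lam / lam * ‖b - b'‖ := by ring
        _ ≤ 1 / 2 * ‖b - b'‖ := mul_le_mul_of_nonneg_right hKlam (norm_nonneg _)
        _ = _ := by simp
  set b := ContractingWith.fixedPoint Φ hcontr with hb
  have hfix : Φ b = b := hcontr.fixedPoint_isFixedPt
  -- closed conditions that the iteration preserves hold for the fixed point
  have hmem : ∀ P : Set (BoundedContinuousFunction (ℝ × ℝ) ℝ), IsClosed P → (0 ∈ P) →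
      (∀ b ∈ P, Φ b ∈ P) → b ∈ P := by
    intro P hP h0 hs
    refine hP.mem_of_tendsto (hcontr.tendsto_iterate_fixedPoint 0) (Eventually.of_forall fun n => ?_)
    induction n with
    | zero => exact h0
    | succ n ih =>
      rw [Function.iterate_succ_apply']
      exact hs _ ih
  have heval : ∀ p, Continuous fun b : BoundedContinuousFunction (ℝ × ℝ) ℝ => b p :=
    fun p => (BoundedContinuousFunction.evalCLM ℝ p).continuous
  -- hence all bounds are linear in the bound `A` of the incident wave
  have hbA : ‖b‖ ≤ A := by
    have h1 : ‖Φ 0‖ ≤ A / 2 := by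
      refine (BoundedContinuousFunction.norm_le (by positivity)).2 fun p => ?_
      rw [hΦ]
      refine (hΦb 0 p (K * A) (by positivity) fun x s hs => ?_).trans ?_
      · refine le_trans ?_ (le_mul_of_one_le_right (by positivity) (hexp1 s hs))
        simp only [src, BoundedContinuousFunction.coe_zero, Pi.zero_apply, mul_zero, add_zero,
          abs_mul]
        exact mul_le_mul (hk.bound x s) (hW.bound x s) (abs_nonneg _) hK
      · calc K * A / lam / lam = K / lam / lam * A := by ring
          _ ≤ 1 / 2 * A := mul_le_mul_of_nonneg_right hKlam hA
          _ = A / 2 := by ring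
    have h2 : ‖Φ b - Φ 0‖ ≤ 1 / 2 * ‖b‖ := by
      have := hcontr.dist_le_mul b 0
      rw [dist_eq_norm, dist_eq_norm, sub_zero] at this
      simpa using this
    have h3 : ‖b‖ ≤ ‖Φ b - Φ 0‖ + ‖Φ 0‖ := by
      calc ‖b‖ = ‖(Φ b - Φ 0) + Φ 0‖ := by rw [sub_add_cancel, hfix]
        _ ≤ _ := norm_add_le _ _
    linarith
  have hbR : ∀ x, ∀ t ∈ Icc 0 N, Real.exp (lam * m t) * b (x, t) = duhamel (src b) x t := by
    intro x t ht
    have : b (x, t) = Real.exp (-(lam * m t)) * duhamel (src b) x (m t) := by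
      conv_lhs => rw [← hfix]
      rw [hΦ]
    rw [this, ← mul_assoc, ← Real.exp_add, add_neg_cancel, Real.exp_zero, one_mul, hmt t ht]
  have hsb : ∀ x t, |src b x t| ≤ K * (1 + E) * A := by
    intro x t
    refine ((hsrc b).bound x t).trans ?_
    rw [mul_assoc]
    refine mul_le_mul_of_nonneg_left ?_ hK
    nlinarith
  have hchar : ∀ x t, t ≤ N → |charIntegral (src b) x t| ≤ K * (1 + E) * N * A ∧
      |charIntegralLeft (src b) x t| ≤ K * (1 + E) * N * A := by
    intro x t ht
    rcases le_total t 0 with h | h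
    · rw [charIntegralLeft, charIntegral_of_nonpos (hsrc0 b) h, charIntegral_of_nonpos
        (f := fun y s => src b (-y) s) (fun x t ht => hsrc0 b _ t ht) h, abs_zero]
      exact ⟨by positivity, by positivity⟩
    · have h1 : K * (1 + E) * A * |t| ≤ K * (1 + E) * N * A := by
        rw [abs_of_nonneg h]
        calc K * (1 + E) * A * t ≤ K * (1 + E) * A * N :=
              mul_le_mul_of_nonneg_left ht (by positivity)
          _ = _ := by ring
      exact ⟨(abs_charIntegral_le hsb).trans h1,
        (abs_charIntegral_le (f := fun y s => src b (-y) s) fun x s => hsb (-x) s).trans h1⟩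
  refine ⟨duhamel (src b), _, _, src b, c1Wave_duhamel (hsrc b) (hsrc0 b),
    fun x t ht => duhamel_of_nonpos (hsrc0 b) ht, fun x t ht => ?_, fun x t ht => ?_,
    fun c hkc hWc => ?_, fun hWc => ?_⟩
  · rcases le_total t 0 with h | h
    · simp [src, hk0 x t h]
    · rw [← hbR x t ⟨h, ht⟩]
  · have hc := hchar x t ht
    have hEA : 0 ≤ E * A := by positivity
    have hKA : 0 ≤ K * (1 + E) * N * A := by positivity
    refine ⟨?_, ?_, ?_⟩
    · rcases le_total t 0 with h | h
      · rw [duhamel_of_nonpos (hsrc0 b) h, abs_zero]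
        positivity
      · rw [← hbR x t ⟨h, ht⟩, abs_mul, abs_of_pos (Real.exp_pos _)]
        have : Real.exp (lam * m t) * |b (x, t)| ≤ E * A :=
          mul_le_mul (Real.exp_le_exp.2 (mul_le_mul_of_nonneg_left (hmN t) hlam0.le))
            ((b.norm_coe_le_norm (x, t)).trans hbA) (abs_nonneg _) hE0.le
        linarith
    · rw [abs_le] at hc ⊢
      rw [abs_le] at hc
      constructor <;> linarith [hc.1.1, hc.1.2, hc.2.1, hc.2.2]
    · rw [abs_le] at hc ⊢
      rw [abs_le] at hc
      constructor <;> linarith [hc.1.1, hc.1.2, hc.2.1, hc.2.2]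
  · have hodd : ∀ b : BoundedContinuousFunction (ℝ × ℝ) ℝ,
        (∀ x t, b (2 * c - x, t) = -b (x, t)) → ∀ x t, src b (2 * c - x) t = -src b x t := by
      intro b hb x t
      simp only [src, hkc, hWc, hb]
      ring
    refine duhamel_odd (hodd b (hmem {b | ∀ x t, b (2 * c - x, t) = -b (x, t)} ?_ ?_ ?_))
    · simp only [ofPred_forall]
      refine isClosed_iInter fun x => isClosed_iInter fun t => ?_
      exact isClosed_eq (heval _) (heval _).neg
    · intro x t
      simp
    · intro b hb x t
      rw [hΦ, hΦ]
      simp only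
      rw [duhamel_odd (hodd b hb)]
      ring
  · have hcone : ∀ b : BoundedContinuousFunction (ℝ × ℝ) ℝ,
        (∀ x t, t ≤ |x| → b (x, t) = 0) → ∀ x t, t ≤ |x| → src b x t = 0 := by
      intro b hb x t ht
      simp [src, hWc x t ht, hb x t ht]
    refine fun x t ht => duhamel_cone
      (hcone b (hmem {b | ∀ x t, t ≤ |x| → b (x, t) = 0} ?_ ?_ ?_)) ht
    · simp only [ofPred_forall]
      refine isClosed_iInter fun x => isClosed_iInter fun t => isClosed_iInter fun _ => ?_
      exact isClosed_eq (heval _) continuous_const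
    · intro x t _
      simp
    · intro b hb x t ht
      rw [hΦ]
      simp only
      rw [duhamel_cone (hcone b hb), mul_zero]
      exact max_le (abs_nonneg x) ((min_le_left _ _).trans ht)

/-! ### Norms of `L²` and primitives of square integrable functions -/

lemma eLpNorm_two_sq {α : Type*} [MeasurableSpace α] {μ : Measure α} (h : α → ℝ) :
    eLpNorm h 2 μ ^ 2 = ∫⁻ x, ‖h x‖ₑ ^ 2 ∂μ := by
  have := eLpNorm_nnreal_pow_eq_lintegral (f := h) (μ := μ) (p := 2) (by norm_num)
  simpa using this

lemma l2Norm_eq_toReal {a b : ℝ} (hab : a ≤ b) {h : ℝ → ℝ}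
    (hm : AEStronglyMeasurable h (volume.restrict (Ioo a b))) :
    l2Norm a b h = (eLpNorm h 2 (volume.restrict (Ioo a b))).toReal := by
  rw [l2Norm, intervalIntegral.integral_of_le hab, integral_Ioc_eq_integral_Ioo,
    integral_eq_lintegral_of_nonneg_ae (Eventually.of_forall fun x => sq_nonneg _) (hm.pow 2)]
  have : ∀ x, ENNReal.ofReal (h x ^ 2) = ‖h x‖ₑ ^ 2 := by
    intro x
    rw [← sq_abs, ENNReal.ofReal_pow (abs_nonneg _), ← Real.norm_eq_abs, ofReal_norm]
  simp_rw [this]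
  rw [← eLpNorm_two_sq, ENNReal.toReal_pow, Real.sqrt_sq ENNReal.toReal_nonneg]

lemma l2Norm_le_of_eLpNorm_le {a b B : ℝ} (hab : a ≤ b) (hB : 0 ≤ B) {h : ℝ → ℝ}
    (hm : AEStronglyMeasurable h (volume.restrict (Ioo a b)))
    (hle : eLpNorm h 2 (volume.restrict (Ioo a b)) ≤ ENNReal.ofReal B) : l2Norm a b h ≤ B := by
  rw [l2Norm_eq_toReal hab hm]
  exact ENNReal.toReal_le_of_le_ofReal hB hle

lemma intervalIntegrable_sq {a b : ℝ} (hab : a ≤ b) {h : ℝ → ℝ} (hm : MemL2 a b h) :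
    IntervalIntegrable (fun x => h x ^ 2) volume a b := by
  rw [intervalIntegrable_iff_integrableOn_Ioo_of_le hab]
  exact hm.integrable_sq

lemma MemL2.intervalIntegrable {a b : ℝ} (hab : a ≤ b) {h : ℝ → ℝ} (hm : MemL2 a b h) :
    IntervalIntegrable h volume a b := by
  rw [intervalIntegrable_iff_integrableOn_Ioo_of_le hab]
  have : IsFiniteMeasure (volume.restrict (Ioo a b)) := ⟨by simp⟩
  exact MemLp.integrable (by norm_num) hm

lemma MeasureTheory.MemLp.intervalIntegrable {h : ℝ → ℝ} (hm : MemLp h 2 volume) (a b : ℝ) :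
    IntervalIntegrable h volume a b := by
  rcases le_total a b with hab | hab
  · exact MemL2.intervalIntegrable hab (hm.restrict _)
  · exact (MemL2.intervalIntegrable hab (hm.restrict _)).symm

/-- `h1Norm` is at most the sum of the two `L²` norms. -/
lemma h1Norm_le {a b : ℝ} (hab : a ≤ b) {h : ℝ → ℝ} (h1 : MemL2 a b (deriv h))
    (h2 : MemL2 a b h) : h1Norm a b h ≤ l2Norm a b (deriv h) + l2Norm a b h := by
  have e1 : 0 ≤ ∫ x in a..b, deriv h x ^ 2 :=
    intervalIntegral.integral_nonneg hab fun x _ => sq_nonneg _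
  have e2 : 0 ≤ ∫ x in a..b, h x ^ 2 :=
    intervalIntegral.integral_nonneg hab fun x _ => sq_nonneg _
  rw [h1Norm, intervalIntegral.integral_add (intervalIntegrable_sq hab h1)
    (intervalIntegrable_sq hab h2), l2Norm, l2Norm]
  refine Real.sqrt_le_iff.2 ⟨by positivity, ?_⟩
  have := mul_nonneg (Real.sqrt_nonneg (∫ x in a..b, deriv h x ^ 2))
    (Real.sqrt_nonneg (∫ x in a..b, h x ^ 2))
  nlinarith [Real.sq_sqrt e1, Real.sq_sqrt e2]

/-- A function with an integrable density is absolutely continuous, and its classical derivative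
is that density. -/
lemma absolutelyContinuous_of_integral {F F' : ℝ → ℝ} {a b : ℝ} (hab : a ≤ b)
    (hi : IntervalIntegrable F' volume a b)
    (hF : ∀ x, F x - F a = ∫ y in a..x, F' y) :
    AbsolutelyContinuousOnInterval F a b ∧
      ∀ᵐ x ∂(volume.restrict (Ioo a b)), HasDerivAt F (F' x) x := by
  have hFe : F = fun x => F a + ∫ y in a..x, F' y := by
    ext x
    rw [← hF]
    ring
  constructor
  · have hc : AbsolutelyContinuousOnInterval (fun _ : ℝ => F a) a b :=
      ((LipschitzWith.const (F a)).lipschitzOnWith (s := uIcc a b)).absolutelyContinuousOnInterval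
    rw [hFe]
    exact hc.add (hi.absolutelyContinuousOnInterval_intervalIntegral left_mem_uIcc)
  · rw [ae_restrict_iff' measurableSet_Ioo]
    filter_upwards [hi.ae_hasDerivAt_integral] with x hx hxab
    rw [hFe]
    exact (hx (by rw [uIcc_of_le hab]; exact Ioo_subset_Icc_self hxab) a left_mem_uIcc).const_add _

/-- `F` is bounded by `A` and is a primitive of `F'`, whose norm in `L²(ℝ)` is at most `A`. -/
structure IsH1Bounded (F F' : ℝ → ℝ) (A : ℝ) : Prop where
  measurable : Measurable F'
  norm_le : eLpNorm F' 2 volume ≤ ENNReal.ofReal A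
  integral : ∀ a b, F b - F a = ∫ x in a..b, F' x
  bound : ∀ x, |F x| ≤ A

namespace IsH1Bounded

variable {F F' G G' : ℝ → ℝ} {A B : ℝ}

lemma nonneg (h : IsH1Bounded F F' A) : 0 ≤ A := (abs_nonneg _).trans (h.bound 0)

lemma memLp (h : IsH1Bounded F F' A) : MemLp F' 2 volume :=
  ⟨h.measurable.aestronglyMeasurable, h.norm_le.trans_lt ENNReal.ofReal_lt_top⟩

lemma intervalIntegrable (h : IsH1Bounded F F' A) (a b : ℝ) : IntervalIntegrable F' volume a b :=
  h.memLp.intervalIntegrable a b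

lemma continuous (h : IsH1Bounded F F' A) : Continuous F := by
  have : F = fun x => F 0 + ∫ y in (0 : ℝ)..x, F' y := by
    ext x
    rw [← h.integral]
    ring
  rw [this]
  exact continuous_const.add (intervalIntegral.continuous_primitive h.intervalIntegrable 0)

lemma mono (h : IsH1Bounded F F' A) (hAB : A ≤ B) : IsH1Bounded F F' B :=
  ⟨h.measurable, h.norm_le.trans (ENNReal.ofReal_le_ofReal hAB), h.integral,
    fun x => (h.bound x).trans hAB⟩

lemma add (hF : IsH1Bounded F F' A) (hG : IsH1Bounded G G' B) :
    IsH1Bounded (fun x => F x + G x) (fun x => F' x + G' x) (A + B) := by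
  refine ⟨hF.measurable.add hG.measurable, ?_, fun a b => ?_,
    fun x => (abs_add_le _ _).trans (add_le_add (hF.bound x) (hG.bound x))⟩
  · rw [ENNReal.ofReal_add hF.nonneg hG.nonneg]
    exact (eLpNorm_add_le hF.measurable.aestronglyMeasurable hG.measurable.aestronglyMeasurable
      (by norm_num)).trans (add_le_add hF.norm_le hG.norm_le)
  · rw [intervalIntegral.integral_add (hF.intervalIntegrable a b) (hG.intervalIntegrable a b),
      ← hF.integral, ← hG.integral]
    ring

lemma const_mul (hF : IsH1Bounded F F' A) (c : ℝ) :
    IsH1Bounded (fun x => c * F x) (fun x => c * F' x) (|c| * A) := by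
  refine ⟨hF.measurable.const_mul c, ?_, fun a b => ?_, fun x => ?_⟩
  · have := eLpNorm_const_smul c F' 2 (volume : Measure ℝ)
    rw [ENNReal.ofReal_mul (abs_nonneg c)]
    calc eLpNorm (fun x => c * F' x) 2 volume = ‖c‖ₑ * eLpNorm F' 2 volume := this
      _ ≤ _ := by
        rw [← Real.norm_eq_abs, ofReal_norm]
        exact mul_le_mul_right hF.norm_le _
  · rw [intervalIntegral.integral_const_mul, ← hF.integral]
    ring
  · rw [abs_mul]
    exact mul_le_mul_of_nonneg_left (hF.bound x) (abs_nonneg c)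

lemma neg (hF : IsH1Bounded F F' A) : IsH1Bounded (fun x => -F x) (fun x => -F' x) A := by
  simpa using hF.const_mul (-1)

lemma const (c : ℝ) : IsH1Bounded (fun _ => c) (fun _ => 0) |c| :=
  ⟨measurable_const, by simp, by simp, fun _ => le_rfl⟩

lemma reflect (hF : IsH1Bounded F F' A) (c : ℝ) :
    IsH1Bounded (fun x => F (c - x)) (fun x => -F' (c - x)) A := by
  have hm : MeasurePreserving (fun x : ℝ => c - x) volume volume :=
    Measure.measurePreserving_sub_left volume c
  refine ⟨(hF.measurable.comp hm.measurable).neg, ?_, fun a b => ?_, fun x => hF.bound _⟩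
  · have : eLpNorm (fun x => -F' (c - x)) 2 volume = eLpNorm F' 2 volume :=
      (eLpNorm_neg (F' ∘ fun x => c - x) 2 volume).trans
        (eLpNorm_comp_measurePreserving hF.measurable.aestronglyMeasurable hm)
    rw [this]
    exact hF.norm_le
  · rw [intervalIntegral.integral_neg, intervalIntegral.integral_comp_sub_left, ← hF.integral]
    ring

lemma translate (hF : IsH1Bounded F F' A) (c : ℝ) :
    IsH1Bounded (fun x => F (x - c)) (fun x => F' (x - c)) A := by
  simpa using (hF.reflect 0).reflect c

/-- The extension of a function on `[a, b]` by constants. -/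
lemma of_clamp {F F' : ℝ → ℝ} {a b A : ℝ} (hab : a ≤ b) (hm : Measurable F')
    (hn : eLpNorm F' 2 (volume.restrict (Ioo a b)) ≤ ENNReal.ofReal A)
    (hi : ∀ x ∈ Icc a b, ∀ y ∈ Icc a b, F y - F x = ∫ z in x..y, F' z)
    (hb : ∀ x ∈ Icc a b, |F x| ≤ A) :
    IsH1Bounded (fun x => F (max a (min x b))) ((Ioo a b).indicator F') A := by
  have hc : ∀ x, max a (min x b) ∈ Icc a b := fun x =>
    ⟨le_max_left _ _, max_le hab (min_le_right _ _)⟩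
  have hmI := hm.indicator (measurableSet_Ioo (a := a) (b := b))
  have hmem : MemLp ((Ioo a b).indicator F') 2 volume := by
    refine ⟨hmI.aestronglyMeasurable, ?_⟩
    rw [eLpNorm_indicator_eq_eLpNorm_restrict measurableSet_Ioo]
    exact hn.trans_lt ENNReal.ofReal_lt_top
  refine ⟨hmI, ?_, ?_, fun x => hb _ (hc x)⟩
  · rw [eLpNorm_indicator_eq_eLpNorm_restrict measurableSet_Ioo]
    exact hn
  · have key : ∀ x, F (max a (min x b)) - F a = ∫ y in a..x, (Ioo a b).indicator F' y := by
      intro x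
      have hzero : ∀ {c d : ℝ}, (∀ y ∈ uIcc c d, y ∉ Ioo a b) →
          ∫ y in c..d, (Ioo a b).indicator F' y = 0 := by
        intro c d h
        rw [intervalIntegral.integral_congr (g := fun _ => (0 : ℝ))]
        · simp
        · intro y hy
          simp [h y hy]
      have hin : ∀ d ∈ Icc a b, ∫ y in a..d, (Ioo a b).indicator F' y = F d - F a := by
        intro d hd
        rw [hi a (left_mem_Icc.2 hab) d hd]
        refine intervalIntegral.integral_congr_ae ?_
        filter_upwards [compl_mem_ae_iff.2 (measure_singleton b)] with y hy hy'
        rw [uIoc_of_le hd.1] at hy'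
        have hyab : y ∈ Ioo a b := ⟨hy'.1, lt_of_le_of_ne (hy'.2.trans hd.2) hy⟩
        exact indicator_of_mem hyab _
      rcases le_total x a with hx | hx
      · rw [max_eq_left ((min_le_left _ _).trans hx), sub_self, hzero]
        intro y hy
        rw [uIcc_of_ge hx] at hy
        exact fun h => absurd h.1 (not_lt.2 hy.2)
      rcases le_total x b with hxb | hxb
      · rw [min_eq_left hxb, max_eq_right hx, hin x ⟨hx, hxb⟩]
      · rw [min_eq_right hxb, max_eq_right hab, ← intervalIntegral.integral_add_adjacent_intervals
          (hmem.intervalIntegrable a b) (hmem.intervalIntegrable b x),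
          hin b (right_mem_Icc.2 hab), hzero, add_zero]
        intro y hy
        rw [uIcc_of_le hxb] at hy
        exact fun h => absurd h.2 (not_lt.2 hy.1)
    intro x y
    have := intervalIntegral.integral_add_adjacent_intervals
      (hmem.intervalIntegrable a x) (hmem.intervalIntegrable x y)
    rw [← key, ← key] at this
    linarith

end IsH1Bounded

lemma eLpNorm_restrict_le_of_bounded {h : ℝ → ℝ} {a b B : ℝ} (hab : a ≤ b)
    (hb : ∀ x ∈ Ioo a b, |h x| ≤ B) :
    eLpNorm h 2 (volume.restrict (Ioo a b)) ≤ ENNReal.ofReal (B * √(b - a)) := by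
  have h1 := eLpNorm_le_of_ae_bound (p := 2) (f := h) (μ := volume.restrict (Ioo a b)) (C := B)
    ((ae_restrict_iff' measurableSet_Ioo).2 (Eventually.of_forall hb))
  refine h1.trans (le_of_eq ?_)
  rw [Measure.restrict_apply_univ, Real.volume_Ioo, mul_comm B,
    ENNReal.ofReal_mul (Real.sqrt_nonneg _), Real.sqrt_eq_rpow,
    ENNReal.ofReal_rpow_of_nonneg (sub_nonneg.2 hab) (by norm_num)]
  norm_num

/-- The extension by constants of a function of `H¹(0, l)` that vanishes at `l`. -/
lemma MemH1.isH1Bounded {l : ℝ} (hl : 0 < l) {φ : ℝ → ℝ} (hφ : MemH1 0 l φ) (h0 : φ l = 0) :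
    IsH1Bounded (fun x => φ (max 0 (min x l))) ((Ioo 0 l).indicator (deriv φ))
      ((1 + √l) * h1Norm 0 l φ) := by
  have hn : l2Norm 0 l (deriv φ) ≤ h1Norm 0 l φ := by
    refine Real.sqrt_le_sqrt (intervalIntegral.integral_mono_on hl.le
      (intervalIntegrable_sq hl.le hφ.2) ?_ fun x _ => by nlinarith [sq_nonneg (φ x)])
    refine (intervalIntegrable_sq hl.le hφ.2).add ?_
    have := hφ.1.continuousOn.pow 2
    exact this.intervalIntegrable
  have hn0 : 0 ≤ h1Norm 0 l φ := Real.sqrt_nonneg _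
  have hdi := hφ.1.intervalIntegrable_deriv
  have hint : ∀ x ∈ Icc 0 l, ∀ y ∈ Icc 0 l, φ y - φ x = ∫ z in x..y, deriv φ z := by
    intro x hx y hy
    refine (AbsolutelyContinuousOnInterval.integral_deriv_eq_sub (hφ.1.mono ?_)).symm
    rw [uIcc_of_le hl.le]
    exact uIcc_subset_Icc hx hy
  have he : eLpNorm (deriv φ) 2 (volume.restrict (Ioo 0 l)) ≤ ENNReal.ofReal (h1Norm 0 l φ) := by
    rw [l2Norm_eq_toReal hl.le hφ.2.1] at hn
    exact (ENNReal.le_ofReal_iff_toReal_le hφ.2.2.ne hn0).2 hn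
  refine IsH1Bounded.of_clamp hl.le (measurable_deriv φ) (he.trans ?_) hint ?_
  · refine ENNReal.ofReal_le_ofReal ?_
    have := Real.sqrt_nonneg l
    nlinarith
  · intro x hx
    have h1 : |φ x| ≤ ∫ z in (0 : ℝ)..l, |deriv φ z| := by
      have := hint x hx l (right_mem_Icc.2 hl.le)
      rw [h0, zero_sub] at this
      rw [← abs_neg, this]
      refine (intervalIntegral.abs_integral_le_integral_abs hx.2).trans ?_
      exact intervalIntegral.integral_mono_interval hx.1 hx.2 le_rfl
        (Eventually.of_forall fun _ => abs_nonneg _) hdi.abs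
    have h2 : ENNReal.ofReal (∫ z in (0 : ℝ)..l, |deriv φ z|)
        ≤ ENNReal.ofReal (√l * h1Norm 0 l φ) := by
      rw [intervalIntegral.integral_of_le hl.le, integral_Ioc_eq_integral_Ioo]
      have h3 := ofReal_integral_norm_eq_lintegral_enorm
        ((intervalIntegrable_iff_integrableOn_Ioo_of_le hl.le).1 hdi)
      simp only [Real.norm_eq_abs] at h3
      rw [h3, ← eLpNorm_one_eq_lintegral_enorm]
      refine (eLpNorm_le_eLpNorm_mul_rpow_measure_univ (p := 1) (q := 2) (by norm_num)
        hφ.2.1).trans ?_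
      rw [Measure.restrict_apply_univ, Real.volume_Ioo, mul_comm,
        ENNReal.ofReal_mul (Real.sqrt_nonneg _)]
      refine mul_le_mul' (le_of_eq ?_) he
      rw [Real.sqrt_eq_rpow, ENNReal.ofReal_rpow_of_nonneg (by linarith) (by norm_num)]
      norm_num
    have h4 := (ENNReal.ofReal_le_ofReal_iff (by positivity)).1 h2
    nlinarith

/-! ### Waves of finite energy -/

/-- `u` is a finite energy solution, with partial derivatives `ux` and `ut`, of
`u_tt - u_xx = f`. The derivatives are continuous curves, in time, in `L²` of every bounded
interval, they have square integrable restrictions to the vertical lines, and the equation is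
stated as a balance law on rectangles. -/
structure EnergyWave (u ux ut f : ℝ → ℝ → ℝ) : Prop where
  continuous : Continuous u.uncurry
  measurable_x : Measurable ux.uncurry
  measurable_t : Measurable ut.uncurry
  measurable : Measurable f.uncurry
  bounded : ∃ M, ∀ x t, |f x t| ≤ M
  memL2_x : ∀ a b t, MemL2 a b fun x => ux x t
  memL2_t : ∀ a b t, MemL2 a b fun x => ut x t
  trace_x : ∀ a b x, MemL2 a b fun t => ux x t
  trace_t : ∀ a b x, MemL2 a b fun t => ut x t
  box_x : ∀ a b c d, MemLp ux.uncurry 2 (volume.restrict (Ioo a b ×ˢ Ioo c d))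
  tendsto_x : ∀ a b t, Tendsto
    (fun s => eLpNorm (fun x => ux x s - ux x t) 2 (volume.restrict (Ioo a b))) (𝓝 t) (𝓝 0)
  tendsto_t : ∀ a b t, Tendsto
    (fun s => eLpNorm (fun x => ut x s - ut x t) 2 (volume.restrict (Ioo a b))) (𝓝 t) (𝓝 0)
  time : ∀ x c d, u x d - u x c = ∫ s in c..d, ut x s
  space : ∀ t a b, u b t - u a t = ∫ x in a..b, ux x t
  flux : ∀ a b c d, (∫ x in a..b, ut x d) - (∫ x in a..b, ut x c)
    = (∫ s in c..d, ux b s) - (∫ s in c..d, ux a s) + ∫ s in c..d, ∫ x in a..b, f x s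

lemma MemL2.intervalIntegrable' {h : ℝ → ℝ} (hm : ∀ a b, MemL2 a b h) (a b : ℝ) :
    IntervalIntegrable h volume a b := by
  rcases le_total a b with hab | hab
  · exact (hm a b).intervalIntegrable hab
  · exact ((hm b a).intervalIntegrable hab).symm

lemma Continuous.memL2 {h : ℝ → ℝ} (hc : Continuous h) (a b : ℝ) : MemL2 a b h := by
  obtain ⟨M, hM⟩ := isCompact_Icc.exists_bound_of_continuousOn (s := Icc a b) hc.continuousOn
  have : IsFiniteMeasure (volume.restrict (Ioo a b)) := ⟨by simp⟩
  refine MemLp.of_bound hc.aestronglyMeasurable M ?_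
  rw [ae_restrict_iff' measurableSet_Ioo]
  exact Eventually.of_forall fun x hx => hM x (Ioo_subset_Icc_self hx)

lemma Continuous.tendsto_eLpNorm_sub {w : ℝ → ℝ → ℝ} (hw : Continuous w.uncurry) (a b t : ℝ) :
    Tendsto (fun s => eLpNorm (fun x => w x s - w x t) 2 (volume.restrict (Ioo a b)))
      (𝓝 t) (𝓝 0) := by
  rcases le_total b a with hab | hab
  · simp [Ioo_eq_empty (not_lt.2 hab)]
  have key : ∀ ε > 0, ∀ᶠ s in 𝓝 t, ∀ x ∈ Icc a b, |w x s - w x t| ≤ ε := by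
    intro ε hε
    have hc : Continuous fun p : ℝ × ℝ => w p.2 p.1 - w p.2 t :=
      (hw.comp continuous_swap).sub (hw.comp (continuous_snd.prodMk continuous_const))
    have := (isCompact_Icc (a := a) (b := b)).eventually_forall_of_forall_eventually
      (x₀ := t) (P := fun s x => |w x s - w x t| ≤ ε) (fun x _ => by
        have h0 : ∀ᶠ z : ℝ × ℝ in 𝓝 (t, x), |w z.2 z.1 - w z.2 t| < ε := by
          refine (hc.abs.continuousAt).eventually_lt continuousAt_const ?_
          simpa using hε
        exact h0.mono fun z hz => hz.le)
    exact this
  rw [ENNReal.tendsto_nhds_zero]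
  intro ε hε
  rcases eq_or_ne ε ⊤ with rfl | hεt
  · simp
  have hε' : 0 < ε.toReal := ENNReal.toReal_pos hε.ne' hεt
  filter_upwards [key (ε.toReal / (√(b - a) + 1)) (by positivity)] with s hs
  refine (eLpNorm_restrict_le_of_bounded hab
    fun x hx => hs x (Ioo_subset_Icc_self hx)).trans ?_
  rw [ENNReal.ofReal_le_iff_le_toReal hεt, div_mul_eq_mul_div, div_le_iff₀ (by positivity)]
  nlinarith

lemma C1Wave.energyWave {R Rx Rt f : ℝ → ℝ → ℝ} (h : C1Wave R Rx Rt f) :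
    EnergyWave R Rx Rt f where
  continuous := h.continuous
  measurable_x := h.continuous_x.measurable
  measurable_t := h.continuous_t.measurable
  measurable := h.measurable
  bounded := h.bounded
  memL2_x a b t := (h.continuous_x_left t).memL2 a b
  memL2_t a b t := (h.continuous_t_left t).memL2 a b
  trace_x a b x := (h.continuous_x_right x).memL2 a b
  trace_t a b x := (h.continuous_t_right x).memL2 a b
  box_x a b c d := by
    have hK : IsCompact (Icc a b ×ˢ Icc c d) := isCompact_Icc.prod isCompact_Icc
    obtain ⟨M, hM⟩ := hK.exists_bound_of_continuousOn h.continuous_x.continuousOn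
    have : IsFiniteMeasure (volume.restrict (Ioo a b ×ˢ Ioo c d)) := by
      rw [Measure.volume_eq_prod, ← Measure.prod_restrict]
      have : IsFiniteMeasure (volume.restrict (Ioo a b)) := ⟨by simp⟩
      have : IsFiniteMeasure (volume.restrict (Ioo c d)) := ⟨by simp⟩
      infer_instance
    refine MemLp.of_bound h.continuous_x.aestronglyMeasurable M ?_
    rw [ae_restrict_iff' (measurableSet_Ioo.prod measurableSet_Ioo)]
    exact Eventually.of_forall fun p hp =>
      hM p ⟨Ioo_subset_Icc_self hp.1, Ioo_subset_Icc_self hp.2⟩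
  tendsto_x a b t := h.continuous_x.tendsto_eLpNorm_sub a b t
  tendsto_t a b t := h.continuous_t.tendsto_eLpNorm_sub a b t
  time := h.time
  space := h.space
  flux := h.flux

/-- Continuity of translations in `L²`. -/
lemma tendsto_eLpNorm_translate {h : ℝ → ℝ} (hh : MemLp h 2 volume) (t : ℝ) :
    Tendsto (fun s => eLpNorm (fun x => h (s - x) - h (t - x)) 2 volume) (𝓝 t) (𝓝 0) := by
  let g : ℝ → C(ℝ, ℝ) := fun s => ⟨fun x => s - x, by fun_prop⟩
  have hg : Continuous g := by
    refine ContinuousMap.continuous_of_continuous_uncurry _ ?_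
    exact continuous_fst.sub continuous_snd
  have hgm : ∀ s, MeasurePreserving (g s) volume volume :=
    fun s => Measure.measurePreserving_sub_left volume s
  have : Fact ((1 : ENNReal) ≤ 2) := ⟨by norm_num⟩
  have hc := (continuous_const (y := hh.toLp h)).compMeasurePreservingLp hg hgm (by norm_num)
  have h1 := tendsto_iff_edist_tendsto_0.1 (hc.tendsto t)
  refine h1.congr fun s => ?_
  rw [Lp.edist_def]
  refine eLpNorm_congr_ae ?_
  have e : ∀ s, Lp.compMeasurePreserving (g s) (hgm s) (hh.toLp h) =ᵐ[volume]
      fun x => h (s - x) := fun s =>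
    (Lp.coeFn_compMeasurePreserving _ (hgm s)).trans
      ((hgm s).quasiMeasurePreserving.ae_eq_comp hh.coeFn_toLp)
  exact (e s).sub (e t)

/-- The wave `F (t - x)` travelling to the right. -/
lemma IsH1Bounded.energyWave {F F' : ℝ → ℝ} {A : ℝ} (h : IsH1Bounded F F' A) :
    EnergyWave (fun x t => F (t - x)) (fun x t => -F' (t - x)) (fun x t => F' (t - x))
      (fun _ _ => 0) := by
  have hm : Measurable (fun x t => F' (t - x)).uncurry :=
    h.measurable.comp (measurable_snd.sub measurable_fst)
  have hL : ∀ a b t, MemL2 a b fun x => F' (t - x) := fun a b t =>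
    (h.memLp.comp_measurePreserving (Measure.measurePreserving_sub_left volume t)).restrict _
  have hT : ∀ a b t, Tendsto
      (fun s => eLpNorm (fun x => F' (s - x) - F' (t - x)) 2 (volume.restrict (Ioo a b)))
      (𝓝 t) (𝓝 0) := fun a b t =>
    tendsto_of_tendsto_of_tendsto_of_le_of_le tendsto_const_nhds
      (tendsto_eLpNorm_translate h.memLp t) (fun _ => zero_le)
      fun s => eLpNorm_mono_measure _ Measure.restrict_le_self
  have htr : ∀ a b x, MemL2 a b fun t => F' (t - x) := fun a b x =>
    (h.memLp.comp_measurePreserving (measurePreserving_sub_right volume x)).restrict _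
  refine ⟨h.continuous.comp (continuous_snd.sub continuous_fst), hm.neg, hm, measurable_const,
    ⟨0, by simp⟩, fun a b t => (hL a b t).neg, hL, fun a b x => (htr a b x).neg, htr, ?_, ?_, hT,
    ?_, ?_, ?_⟩
  · intro a b c d
    refine MemLp.neg ?_
    refine (memLp_two_iff_integrable_sq (f := fun p : ℝ × ℝ => F' (p.2 - p.1))
      hm.aestronglyMeasurable).2 ?_
    have h1 : Integrable ((Ioo a b).indicator fun _ : ℝ => (1 : ℝ)) volume :=
      (integrable_indicator_iff measurableSet_Ioo).2 (by simp)
    have h2 := (h1.convolution_integrand (ContinuousLinearMap.mul ℝ ℝ)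
      h.memLp.integrable_sq).swap
    have h3 : IntegrableOn (fun p : ℝ × ℝ => F' (p.2 - p.1) ^ 2) (Ioo a b ×ˢ univ) := by
      rw [← integrable_indicator_iff (measurableSet_Ioo.prod MeasurableSet.univ)]
      refine h2.congr (Eventually.of_forall fun p => ?_)
      by_cases hp : p.1 ∈ Ioo a b
      · simp only [mem_Ioo] at hp
        simp [hp]
      · simp only [mem_Ioo] at hp
        simp [hp]
    exact h3.mono_set (prod_mono le_rfl (subset_univ _))
  · intro a b t
    refine (hT a b t).congr fun s => ?_
    rw [← eLpNorm_neg]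
    congr 1
    ext x
    simp only [Pi.neg_apply]
    ring
  · intro x c d
    rw [intervalIntegral.integral_comp_sub_right, h.integral]
  · intro t a b
    rw [intervalIntegral.integral_neg, intervalIntegral.integral_comp_sub_left, ← h.integral]
    ring
  · intro a b c d
    simp only [intervalIntegral.integral_neg, intervalIntegral.integral_comp_sub_left,
      intervalIntegral.integral_comp_sub_right, intervalIntegral.integral_zero, ← h.integral]
    ring

namespace EnergyWave

variable {u ux ut f u' ux' ut' f' : ℝ → ℝ → ℝ}

lemma tendsto_add {w w' : ℝ → ℝ → ℝ} {a b t : ℝ} (hw : Measurable w.uncurry)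
    (hw' : Measurable w'.uncurry)
    (h : Tendsto (fun s => eLpNorm (fun x => w x s - w x t) 2 (volume.restrict (Ioo a b)))
      (𝓝 t) (𝓝 0))
    (h' : Tendsto (fun s => eLpNorm (fun x => w' x s - w' x t) 2 (volume.restrict (Ioo a b)))
      (𝓝 t) (𝓝 0)) :
    Tendsto (fun s => eLpNorm (fun x => (w x s + w' x s) - (w x t + w' x t)) 2
      (volume.restrict (Ioo a b))) (𝓝 t) (𝓝 0) := by
  have hs := h.add h'
  rw [add_zero] at hs
  refine tendsto_of_tendsto_of_tendsto_of_le_of_le tendsto_const_nhds hs (fun _ => zero_le)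
    fun s => ?_
  have hm : ∀ {w : ℝ → ℝ → ℝ}, Measurable w.uncurry → ∀ s, Measurable fun x => w x s :=
    fun hw s => hw.comp (measurable_prodMk_right (y := s))
  refine le_trans (le_of_eq ?_) (eLpNorm_add_le ((hm hw s).sub (hm hw t)).aestronglyMeasurable
    ((hm hw' s).sub (hm hw' t)).aestronglyMeasurable (by norm_num))
  congr 1
  ext x
  simp only [Pi.add_apply]
  ring

lemma intervalIntegrable_source (h : EnergyWave u ux ut f) (t a b : ℝ) :
    IntervalIntegrable (fun x => f x t) volume a b := by
  obtain ⟨M, hM⟩ := h.bounded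
  exact intervalIntegrable_of_bounded (h.measurable.comp (measurable_prodMk_right (y := t)))
    (fun x => hM x t) a b

lemma intervalIntegrable_source' (h : EnergyWave u ux ut f) (a b c d : ℝ) :
    IntervalIntegrable (fun s => ∫ x in a..b, f x s) volume c d := by
  obtain ⟨M, hM⟩ := h.bounded
  exact intervalIntegrable_intervalIntegral (F := fun s x => f x s)
    (h.measurable.comp measurable_swap) (fun s x => hM x s) a b c d

lemma integrable_xl (h : EnergyWave u ux ut f) (t a b : ℝ) :
    IntervalIntegrable (fun x => ux x t) volume a b :=
  MemL2.intervalIntegrable' (fun a b => h.memL2_x a b t) a b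

lemma integrable_tl (h : EnergyWave u ux ut f) (t a b : ℝ) :
    IntervalIntegrable (fun x => ut x t) volume a b :=
  MemL2.intervalIntegrable' (fun a b => h.memL2_t a b t) a b

lemma integrable_xr (h : EnergyWave u ux ut f) (x a b : ℝ) :
    IntervalIntegrable (fun t => ux x t) volume a b :=
  MemL2.intervalIntegrable' (fun a b => h.trace_x a b x) a b

lemma integrable_tr (h : EnergyWave u ux ut f) (x a b : ℝ) :
    IntervalIntegrable (fun t => ut x t) volume a b :=
  MemL2.intervalIntegrable' (fun a b => h.trace_t a b x) a b

lemma add (h : EnergyWave u ux ut f) (h' : EnergyWave u' ux' ut' f') :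
    EnergyWave (fun x t => u x t + u' x t) (fun x t => ux x t + ux' x t)
      (fun x t => ut x t + ut' x t) (fun x t => f x t + f' x t) := by
  obtain ⟨M, hM⟩ := h.bounded
  obtain ⟨M', hM'⟩ := h'.bounded
  refine ⟨h.continuous.add h'.continuous, h.measurable_x.add h'.measurable_x,
    h.measurable_t.add h'.measurable_t, h.measurable.add h'.measurable,
    ⟨M + M', fun x t => (abs_add_le _ _).trans (add_le_add (hM x t) (hM' x t))⟩,
    fun a b t => (h.memL2_x a b t).add (h'.memL2_x a b t),
    fun a b t => (h.memL2_t a b t).add (h'.memL2_t a b t),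
    fun a b t => (h.trace_x a b t).add (h'.trace_x a b t),
    fun a b t => (h.trace_t a b t).add (h'.trace_t a b t),
    fun a b c d => (h.box_x a b c d).add (h'.box_x a b c d),
    fun a b t => tendsto_add h.measurable_x h'.measurable_x (h.tendsto_x a b t)
      (h'.tendsto_x a b t),
    fun a b t => tendsto_add h.measurable_t h'.measurable_t (h.tendsto_t a b t)
      (h'.tendsto_t a b t), ?_, ?_, ?_⟩
  · intro x c d
    rw [intervalIntegral.integral_add (h.integrable_tr x c d) (h'.integrable_tr x c d),
      ← h.time, ← h'.time]
    ring
  · intro t a b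
    rw [intervalIntegral.integral_add (h.integrable_xl t a b) (h'.integrable_xl t a b),
      ← h.space, ← h'.space]
    ring
  · intro a b c d
    have hs := fun s => intervalIntegral.integral_add (h.intervalIntegrable_source s a b)
      (h'.intervalIntegrable_source s a b)
    simp_rw [hs]
    rw [intervalIntegral.integral_add (h.intervalIntegrable_source' a b c d)
        (h'.intervalIntegrable_source' a b c d),
      intervalIntegral.integral_add (h.integrable_tl d a b) (h'.integrable_tl d a b),
      intervalIntegral.integral_add (h.integrable_tl c a b) (h'.integrable_tl c a b),
      intervalIntegral.integral_add (h.integrable_xr a c d) (h'.integrable_xr a c d),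
      intervalIntegral.integral_add (h.integrable_xr b c d) (h'.integrable_xr b c d)]
    linarith [h.flux a b c d, h'.flux a b c d]

lemma reflect (h : EnergyWave u ux ut f) :
    EnergyWave (fun x t => u (-x) t) (fun x t => -ux (-x) t) (fun x t => ut (-x) t)
      (fun x t => f (-x) t) := by
  obtain ⟨M, hM⟩ := h.bounded
  have hc : Continuous fun p : ℝ × ℝ => (-p.1, p.2) := by fun_prop
  have hpre : ∀ a b : ℝ, (fun x : ℝ => -x) ⁻¹' Ioo (-b) (-a) = Ioo a b := fun a b => by
    ext x
    simp only [mem_preimage, mem_Ioo, neg_lt_neg_iff]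
    exact and_comm
  have hmp : ∀ a b : ℝ, MeasurePreserving (fun x : ℝ => -x) (volume.restrict (Ioo a b))
      (volume.restrict (Ioo (-b) (-a))) := fun a b => by
    have := (Measure.measurePreserving_neg (volume : Measure ℝ)).restrict_preimage
      (measurableSet_Ioo (a := -b) (b := -a))
    rwa [hpre] at this
  have hm : ∀ {w : ℝ → ℝ → ℝ}, Measurable w.uncurry → ∀ s, Measurable fun x => w x s :=
    fun hw s => hw.comp (measurable_prodMk_right (y := s))
  have hten : ∀ {w : ℝ → ℝ → ℝ}, Measurable w.uncurry →
      (∀ a b t, Tendsto (fun s => eLpNorm (fun x => w x s - w x t) 2 (volume.restrict (Ioo a b)))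
        (𝓝 t) (𝓝 0)) → ∀ a b t,
      Tendsto (fun s => eLpNorm (fun x => w (-x) s - w (-x) t) 2 (volume.restrict (Ioo a b)))
        (𝓝 t) (𝓝 0) := by
    intro w hw h a b t
    refine (h (-b) (-a) t).congr fun s => ?_
    exact (eLpNorm_comp_measurePreserving ((hm hw s).sub (hm hw t)).aestronglyMeasurable
      (hmp a b)).symm
  refine ⟨h.continuous.comp hc, (h.measurable_x.comp hc.measurable).neg,
    h.measurable_t.comp hc.measurable, h.measurable.comp hc.measurable,
    ⟨M, fun x t => hM _ t⟩,
    fun a b t => ((h.memL2_x (-b) (-a) t).comp_measurePreserving (hmp a b)).neg,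
    fun a b t => (h.memL2_t (-b) (-a) t).comp_measurePreserving (hmp a b),
    fun a b x => (h.trace_x a b (-x)).neg, fun a b x => h.trace_t a b (-x), ?_, ?_,
    hten h.measurable_t h.tendsto_t, ?_, ?_, ?_⟩
  · intro a b c d
    have hp : MeasurePreserving (fun p : ℝ × ℝ => (-p.1, p.2))
        (volume.restrict (Ioo a b ×ˢ Ioo c d)) (volume.restrict (Ioo (-b) (-a) ×ˢ Ioo c d)) := by
      rw [Measure.volume_eq_prod, ← Measure.prod_restrict, ← Measure.prod_restrict]
      exact (hmp a b).prod (MeasurePreserving.id _)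
    exact ((h.box_x (-b) (-a) c d).comp_measurePreserving hp).neg
  · intro a b t
    refine (hten h.measurable_x h.tendsto_x a b t).congr fun s => ?_
    rw [← eLpNorm_neg]
    congr 1
    ext x
    simp only [Pi.neg_apply]
    ring
  · intro x c d
    exact h.time _ c d
  · intro t a b
    rw [intervalIntegral.integral_neg,
      intervalIntegral.integral_comp_neg (fun x => ux x t), ← h.space]
    ring
  · intro a b c d
    have e := h.flux (-b) (-a) c d
    simp only [intervalIntegral.integral_neg]
    rw [intervalIntegral.integral_comp_neg (fun x => ut x d),
      intervalIntegral.integral_comp_neg (fun x => ut x c)]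
    have : ∀ s, ∫ x in a..b, f (-x) s = ∫ x in (-b)..(-a), f x s :=
      fun s => intervalIntegral.integral_comp_neg (fun x => f x s)
    simp_rw [this]
    linarith

end EnergyWave

/-- The wave `G (t + x)` travelling to the left. -/
lemma IsH1Bounded.energyWave_left {G G' : ℝ → ℝ} {A : ℝ} (h : IsH1Bounded G G' A) :
    EnergyWave (fun x t => G (t + x)) (fun x t => G' (t + x)) (fun x t => G' (t + x))
      (fun _ _ => 0) := by
  simpa using h.energyWave.reflect

/-! ### Finite energy waves are weak solutions on an edge -/

/-- The average over a time interval of a curve in `L²` is bounded in `L²` by the supremum of the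
norms over that interval. -/
lemma eLpNorm_average_le {w : ℝ → ℝ → ℝ} (hw : Measurable w.uncurry) {a b s t : ℝ} {ε : ENNReal}
    (hst : s ≠ t)
    (h : ∀ r ∈ uIcc t s, eLpNorm (fun x => w x r) 2 (volume.restrict (Ioo a b)) ≤ ε) :
    eLpNorm (fun x => (∫ r in t..s, w x r) / (s - t)) 2 (volume.restrict (Ioo a b)) ≤ ε := by
  set μ := volume.restrict (Ioo a b)
  set ν := volume.restrict (uIoc t s)
  have hν : ν univ = ENNReal.ofReal |s - t| := by
    simp only [ν, Measure.restrict_apply_univ]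
    rw [uIoc, Real.volume_Ioc, max_sub_min_eq_abs]
  have hpos : 0 < |s - t| := abs_pos.2 (sub_ne_zero.2 hst)
  set c := ENNReal.ofReal |s - t| with hc
  have hc0 : c ≠ 0 := by simpa [hc] using sub_ne_zero.2 hst
  have hct : c ≠ ⊤ := ENNReal.ofReal_ne_top
  have hpt : ∀ x, ‖(∫ r in t..s, w x r) / (s - t)‖ₑ ^ 2 ≤ c⁻¹ * ∫⁻ r, ‖w x r‖ₑ ^ 2 ∂ν := by
    intro x
    have h1 : ‖(∫ r in t..s, w x r)‖ₑ ≤ ∫⁻ r, ‖w x r‖ₑ ∂ν := by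
      rw [← ofReal_norm, intervalIntegral.norm_intervalIntegral_eq, ofReal_norm]
      exact enorm_integral_le_lintegral_enorm _
    have h2 : (∫⁻ r, ‖w x r‖ₑ ∂ν) ^ 2 ≤ c * ∫⁻ r, ‖w x r‖ₑ ^ 2 ∂ν := by
      have hm : AEStronglyMeasurable (fun r => w x r) ν :=
        (hw.comp (measurable_prodMk_left (x := x))).aestronglyMeasurable
      rw [← eLpNorm_one_eq_lintegral_enorm, ← eLpNorm_two_sq]
      refine (pow_le_pow_left' (eLpNorm_le_eLpNorm_mul_rpow_measure_univ (p := 1) (q := 2)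
        (by norm_num) hm) 2).trans ?_
      rw [mul_pow, hν, mul_comm, ← ENNReal.rpow_natCast (c ^ _), ← ENNReal.rpow_mul]
      norm_num
    rw [div_eq_mul_inv, enorm_mul, mul_pow]
    have h3 : ‖(s - t)⁻¹‖ₑ = c⁻¹ := by
      rw [hc, ← ENNReal.ofReal_inv_of_pos hpos, ← abs_inv, ← Real.norm_eq_abs, ofReal_norm]
    rw [h3]
    calc ‖(∫ r in t..s, w x r)‖ₑ ^ 2 * c⁻¹ ^ 2
        ≤ (c * ∫⁻ r, ‖w x r‖ₑ ^ 2 ∂ν) * c⁻¹ ^ 2 :=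
          mul_le_mul_left ((pow_le_pow_left' h1 2).trans h2) _
      _ = (c * c⁻¹) * (c⁻¹ * ∫⁻ r, ‖w x r‖ₑ ^ 2 ∂ν) := by ring
      _ = _ := by rw [ENNReal.mul_inv_cancel hc0 hct, one_mul]
  have hm2 : Measurable fun p : ℝ × ℝ => ‖w p.1 p.2‖ₑ ^ 2 := hw.enorm.pow_const 2
  have hsq : eLpNorm (fun x => (∫ r in t..s, w x r) / (s - t)) 2 μ ^ 2 ≤ ε ^ 2 := by
    rw [eLpNorm_two_sq]
    calc ∫⁻ x, ‖(∫ r in t..s, w x r) / (s - t)‖ₑ ^ 2 ∂μ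
        ≤ ∫⁻ x, c⁻¹ * ∫⁻ r, ‖w x r‖ₑ ^ 2 ∂ν ∂μ := lintegral_mono hpt
      _ = c⁻¹ * ∫⁻ x, ∫⁻ r, ‖w x r‖ₑ ^ 2 ∂ν ∂μ :=
          lintegral_const_mul _ hm2.lintegral_prod_right'
      _ = c⁻¹ * ∫⁻ r, ∫⁻ x, ‖w x r‖ₑ ^ 2 ∂μ ∂ν := by
          rw [lintegral_lintegral_swap hm2.aemeasurable]
      _ ≤ c⁻¹ * ∫⁻ r, ε ^ 2 ∂ν := by
          refine mul_le_mul_right (setLIntegral_mono measurable_const fun r hr => ?_) _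
          rw [← eLpNorm_two_sq]
          exact pow_le_pow_left' (h r (uIoc_subset_uIcc hr)) 2
      _ = ε ^ 2 := by
          rw [lintegral_const, hν, mul_comm (ε ^ 2), ← mul_assoc, ENNReal.inv_mul_cancel hc0 hct,
            one_mul]
  exact (ENNReal.pow_le_pow_left_iff two_ne_zero).1 hsq

namespace EnergyWave

variable {u ux ut f : ℝ → ℝ → ℝ} {l T : ℝ}

lemma slice (h : EnergyWave u ux ut f) (hl : 0 < l) (t : ℝ) :
    AbsolutelyContinuousOnInterval (fun x => u x t) 0 l ∧
      ∀ᵐ x ∂(volume.restrict (Ioo 0 l)), HasDerivAt (fun x => u x t) (ux x t) x :=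
  absolutelyContinuous_of_integral hl.le (h.integrable_xl t 0 l) fun x => h.space t 0 x

lemma deriv_slice (h : EnergyWave u ux ut f) (hl : 0 < l) (t : ℝ) :
    deriv (fun x => u x t) =ᵐ[volume.restrict (Ioo 0 l)] fun x => ux x t := by
  filter_upwards [(h.slice hl t).2] with x hx using hx.deriv

lemma continuousIntoH1 (h : EnergyWave u ux ut f) (hl : 0 < l) :
    ContinuousIntoH1 l T (fun t x => u x t) := by
  have hmem : ∀ t, MemH1 0 l (fun x => u x t) := fun t =>
    ⟨(h.slice hl t).1, (memLp_congr_ae (h.deriv_slice hl t)).2 (h.memL2_x 0 l t)⟩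
  refine ⟨fun t _ => hmem t, fun t _ => tendsto_nhdsWithin_of_tendsto_nhds ?_⟩
  have hc : ∀ t, Continuous fun x => u x t := fun t =>
    h.continuous.comp (continuous_id.prodMk continuous_const)
  have hd : ∀ s, deriv (fun x => u x s - u x t) =ᵐ[volume.restrict (Ioo 0 l)]
      fun x => ux x s - ux x t := by
    intro s
    filter_upwards [(h.slice hl s).2, (h.slice hl t).2] with x hs ht using (hs.sub ht).deriv
  have hle : ∀ s, h1Norm 0 l (fun x => u x s - u x t) ≤
      (eLpNorm (fun x => ux x s - ux x t) 2 (volume.restrict (Ioo 0 l))).toReal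
      + (eLpNorm (fun x => u x s - u x t) 2 (volume.restrict (Ioo 0 l))).toReal := by
    intro s
    have m1 : MemL2 0 l (deriv fun x => u x s - u x t) :=
      (memLp_congr_ae (hd s)).2 ((h.memL2_x 0 l s).sub (h.memL2_x 0 l t))
    have m2 : MemL2 0 l fun x => u x s - u x t := ((hc s).sub (hc t)).memL2 0 l
    refine (h1Norm_le hl.le m1 m2).trans ?_
    rw [l2Norm_eq_toReal hl.le m1.1, l2Norm_eq_toReal hl.le m2.1, eLpNorm_congr_ae (hd s)]
  refine squeeze_zero (fun s => Real.sqrt_nonneg _) hle ?_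
  have h1 := (ENNReal.tendsto_toReal ENNReal.zero_ne_top).comp (h.tendsto_x 0 l t)
  have h2 := (ENNReal.tendsto_toReal ENNReal.zero_ne_top).comp
    (h.continuous.tendsto_eLpNorm_sub 0 l t)
  simpa using h1.add h2

lemma measurable_tl (h : EnergyWave u ux ut f) (t : ℝ) : Measurable fun x => ut x t :=
  h.measurable_t.comp (measurable_prodMk_right (y := t))

lemma continuousIntoL2 (h : EnergyWave u ux ut f) (hl : 0 < l) :
    ContinuousIntoL2 l T (fun t x => ut x t) := by
  refine ⟨fun t _ => h.memL2_t 0 l t, fun t _ => tendsto_nhdsWithin_of_tendsto_nhds ?_⟩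
  have h1 := (ENNReal.tendsto_toReal ENNReal.zero_ne_top).comp (h.tendsto_t 0 l t)
  refine h1.congr fun s => ?_
  exact (l2Norm_eq_toReal hl.le
    ((h.measurable_tl s).sub (h.measurable_tl t)).aestronglyMeasurable).symm

lemma isTimeDerivative (h : EnergyWave u ux ut f) (hl : 0 < l) :
    IsTimeDerivative l T (fun t x => u x t) (fun t x => ut x t) := by
  intro t _
  refine tendsto_nhdsWithin_mono_left (t := {t}ᶜ) (fun s hs => hs.2) ?_
  have hc : ∀ t, Measurable fun x => u x t := fun t =>
    h.continuous.measurable.comp (measurable_prodMk_right (y := t))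
  have hm : ∀ s, AEStronglyMeasurable (fun x => (u x s - u x t) / (s - t) - ut x t)
      (volume.restrict (Ioo 0 l)) := fun s =>
    ((((hc s).sub (hc t)).div_const _).sub (h.measurable_tl t)).aestronglyMeasurable
  have key : Tendsto (fun s => eLpNorm (fun x => (u x s - u x t) / (s - t) - ut x t) 2
      (volume.restrict (Ioo 0 l))) (𝓝[≠] t) (𝓝 0) := by
    rw [ENNReal.tendsto_nhds_zero]
    intro ε hε
    obtain ⟨δ, hδ, hball⟩ := Metric.eventually_nhds_iff_ball.1
      (ENNReal.tendsto_nhds_zero.1 (h.tendsto_t 0 l t) ε hε)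
    filter_upwards [self_mem_nhdsWithin,
      mem_nhdsWithin_of_mem_nhds (Metric.ball_mem_nhds t hδ)] with s hs hsb
    have hne : s - t ≠ 0 := sub_ne_zero.2 hs
    have he : ∀ x, (u x s - u x t) / (s - t) - ut x t
        = (∫ r in t..s, (ut x r - ut x t)) / (s - t) := by
      intro x
      rw [intervalIntegral.integral_sub (h.integrable_tr x t s) intervalIntegrable_const,
        ← h.time, intervalIntegral.integral_const, smul_eq_mul]
      field_simp
    simp_rw [he]
    refine eLpNorm_average_le (w := fun x r => ut x r - ut x t)
      (h.measurable_t.sub ((h.measurable_tl t).comp measurable_fst)) hs fun r hr => hball r ?_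
    exact (convex_ball t δ).ordConnected.uIcc_subset (Metric.mem_ball_self hδ) hsb hr
  have h1 := (ENNReal.tendsto_toReal ENNReal.zero_ne_top).comp key
  refine h1.congr fun s => ?_
  rw [l2Norm_eq_toReal hl.le (hm s)]
  rfl

/-- The equation of a finite energy wave with zero initial velocity, tested against `y`. -/
lemma weak_form (h : EnergyWave u ux ut f) (hl : 0 < l)
    (h0 : ∀ᵐ x ∂(volume.restrict (Ioo 0 l)), ut x 0 = 0) {y : ℝ → ℝ} (hy : MemH1 0 l y)
    (hyl : y l = 0) {t : ℝ} (ht : 0 ≤ t) :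
    ∫ x in (0 : ℝ)..l, ut x t * y x = -∫ s in (0 : ℝ)..t,
      ((∫ x in (0 : ℝ)..l, (ux x s * deriv y x - f x s * y x)) + ux 0 s * y 0) := by
  obtain ⟨M, hM⟩ := h.bounded
  have hyc : ContinuousOn y (uIcc 0 l) := hy.1.continuousOn
  have hs0 : Ioo 0 l ×ˢ Ioo 0 t =ᵐ[volume] uIoc 0 l ×ˢ uIoc 0 t := by
    rw [uIoc_of_le hl.le, uIoc_of_le ht, Measure.volume_eq_prod]
    exact Measure.set_prod_ae_eq Ioo_ae_eq_Ioc Ioo_ae_eq_Ioc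
  -- Fubini's theorem for the two terms of the integrand
  have i1 : IntegrableOn (fun p : ℝ × ℝ => ux p.1 p.2 * deriv y p.1)
      (uIoc 0 l ×ˢ uIoc 0 t) := by
    refine IntegrableOn.congr_set_ae ?_ hs0.symm
    have hd : MemLp (fun p : ℝ × ℝ => deriv y p.1) 2
        (volume.restrict (Ioo 0 l ×ˢ Ioo 0 t)) := by
      refine (memLp_two_iff_integrable_sq (f := fun p : ℝ × ℝ => deriv y p.1)
        ((measurable_deriv y).comp measurable_fst).aestronglyMeasurable).2 ?_
      rw [Measure.volume_eq_prod, ← Measure.prod_restrict]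
      have : IsFiniteMeasure (volume.restrict (Ioo 0 t)) := ⟨by simp⟩
      exact (MemLp.integrable_sq hy.2).comp_fst _
    exact MemLp.integrable_mul (h.box_x 0 l 0 t) hd
  have i2 : IntegrableOn (fun p : ℝ × ℝ => f p.1 p.2 * y p.1) (uIoc 0 l ×ˢ uIoc 0 t) := by
    have hyp : IntegrableOn (fun p : ℝ × ℝ => y p.1) (uIoc 0 l ×ˢ uIoc 0 t) := by
      rw [IntegrableOn, Measure.volume_eq_prod, ← Measure.prod_restrict]
      have : IsFiniteMeasure (volume.restrict (uIoc 0 t)) := ⟨by simp [uIoc]⟩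
      exact (intervalIntegrable_iff.1 hyc.intervalIntegrable).comp_fst _
    exact hyp.bdd_mul h.measurable.aestronglyMeasurable
      (Eventually.of_forall fun p => hM p.1 p.2)
  have sw1 := intervalIntegral_intervalIntegral_swap (F := fun x s => ux x s * deriv y x) i1
  have sw2 := intervalIntegral_intervalIntegral_swap (F := fun x s => f x s * y x) i2
  have hix : ∀ s, IntervalIntegrable (fun x => f x s * y x) volume 0 l := fun s =>
    (h.intervalIntegrable_source s 0 l).mul_continuousOn hyc
  have hswap : ∀ {F : ℝ → ℝ → ℝ}, IntegrableOn F.uncurry (uIoc 0 l ×ˢ uIoc 0 t) →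
      IntervalIntegrable (fun s => ∫ x in (0 : ℝ)..l, F x s) volume 0 t := by
    intro F hF
    rw [IntegrableOn, Measure.volume_eq_prod, ← Measure.prod_restrict] at hF
    rw [intervalIntegrable_iff]
    refine hF.integral_prod_right.congr (Eventually.of_forall fun s => ?_)
    simp only [intervalIntegral.intervalIntegral_eq_integral_uIoc, hl.le, if_true, one_smul]
    rfl
  have hixy : ∀ s, IntervalIntegrable (fun x => ux x s * deriv y x) volume 0 l := by
    intro s
    rw [intervalIntegrable_iff_integrableOn_Ioo_of_le hl.le]
    exact MemLp.integrable_mul (h.memL2_x 0 l s) hy.2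
  have hsplit : ∀ s, ∫ x in (0 : ℝ)..l, (ux x s * deriv y x - f x s * y x)
      = (∫ x in (0 : ℝ)..l, ux x s * deriv y x) - ∫ x in (0 : ℝ)..l, f x s * y x :=
    fun s => intervalIntegral.integral_sub (hixy s) (hix s)
  simp_rw [hsplit]
  have j1 := hswap (F := fun x s => ux x s * deriv y x) i1
  have j2 := hswap (F := fun x s => f x s * y x) i2
  rw [intervalIntegral.integral_add (j1.sub j2) ((h.integrable_xr 0 0 t).mul_const _),
    intervalIntegral.integral_sub j1 j2, ← sw1, ← sw2,
    intervalIntegral.integral_mul_const]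
  simp only [intervalIntegral.integral_mul_const]
  -- integration by parts in space against the impulse `P` of the flux
  set P : ℝ → ℝ := fun x => ∫ s in (0 : ℝ)..t, ux x s with hP
  set S : ℝ → ℝ := fun x => ∫ s in (0 : ℝ)..t, f x s with hS
  have hSi : ∀ a b, IntervalIntegrable S volume a b := fun a b =>
    intervalIntegrable_intervalIntegral h.measurable hM 0 t a b
  have hPi : ∀ x, P x - P 0 = ∫ z in (0 : ℝ)..x, (ut z t - ut z 0 - S z) := by
    intro x
    rw [intervalIntegral.integral_sub ((h.integrable_tl t 0 x).sub (h.integrable_tl 0 0 x))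
      (hSi 0 x), intervalIntegral.integral_sub (h.integrable_tl t 0 x) (h.integrable_tl 0 0 x)]
    have hfl := h.flux 0 x 0 t
    have hSf : ∫ s in (0 : ℝ)..t, ∫ z in (0 : ℝ)..x, f z s = ∫ z in (0 : ℝ)..x, S z :=
      intervalIntegral_swap_of_bounded (F := fun s z => f z s)
        (h.measurable.comp measurable_swap) (fun s z => hM z s) _ _ _ _
    rw [hSf] at hfl
    simp only [hP]
    linarith
  obtain ⟨hPac, hPd⟩ := absolutelyContinuous_of_integral hl.le
    (((h.integrable_tl t 0 l).sub (h.integrable_tl 0 0 l)).sub (hSi 0 l)) hPi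
  have hibp := hPac.integral_mul_deriv_eq_deriv_mul hy.1
  have hPd' : ∫ x in (0 : ℝ)..l, deriv P x * y x
      = (∫ x in (0 : ℝ)..l, ut x t * y x) - ∫ x in (0 : ℝ)..l, S x * y x := by
    rw [← intervalIntegral.integral_sub ((h.integrable_tl t 0 l).mul_continuousOn hyc)
      ((hSi 0 l).mul_continuousOn hyc)]
    rw [intervalIntegral.integral_of_le hl.le, intervalIntegral.integral_of_le hl.le,
      integral_Ioc_eq_integral_Ioo, integral_Ioc_eq_integral_Ioo]
    refine integral_congr_ae ?_
    filter_upwards [hPd, h0] with x hx hx0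
    rw [hx.deriv, hx0]
    ring
  rw [hPd', hyl, mul_zero] at hibp
  linarith

theorem isWeakEdgeSolution (h : EnergyWave u ux ut f) (hl : 0 < l) {q : ℝ → ℝ}
    (h0 : ∀ x ∈ Icc 0 l, u x 0 = 0)
    (ht0 : ∀ᵐ x ∂(volume.restrict (Ioo 0 l)), ut x 0 = 0)
    (hf : ∀ x ∈ Ioo 0 l, ∀ t ∈ Ioo 0 T, f x t = -(q x * u x t)) :
    IsWeakEdgeSolution l T q (fun t => ux 0 t) (fun t x => u x t) := by
  refine ⟨h.continuousIntoH1 hl, h.trace_x 0 T 0, h0, fun t x => ut x t, h.continuousIntoL2 hl,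
    h.isTimeDerivative hl, ht0, fun y hy hyl t ht => ?_⟩
  rw [h.weak_form hl ht0 hy hyl ht.1]
  congr 1
  rw [intervalIntegral.integral_of_le ht.1, intervalIntegral.integral_of_le ht.1,
    integral_Ioc_eq_integral_Ioo, integral_Ioc_eq_integral_Ioo]
  refine setIntegral_congr_fun measurableSet_Ioo fun s hs => ?_
  simp only
  congr 1
  rw [intervalIntegral.integral_of_le hl.le, intervalIntegral.integral_of_le hl.le,
    integral_Ioc_eq_integral_Ioo, integral_Ioc_eq_integral_Ioo]
  refine setIntegral_congr_ae measurableSet_Ioo ?_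
  have hd := h.deriv_slice hl s
  rw [Filter.EventuallyEq, ae_restrict_iff' measurableSet_Ioo] at hd
  filter_upwards [hd] with x hx hxl
  rw [hx hxl, hf x hxl s ⟨hs.1, hs.2.trans_le ht.2⟩]
  ring

end EnergyWave

/-! ### Shape control and jump waves on a string -/

/-- Bounded measurable functions on the line that are continuous off a countable set. -/
structure IsPiecewiseContinuous (κ : ℝ → ℝ) (K : ℝ) : Prop where
  measurable : Measurable κ
  bound : ∀ x, |κ x| ≤ K
  continuousAt : ∃ S : Set ℝ, S.Countable ∧ ∀ x ∉ S, ContinuousAt κ x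

namespace IsPiecewiseContinuous

variable {κ : ℝ → ℝ} {K : ℝ}

lemma gridContinuous_fst (h : IsPiecewiseContinuous κ K) : IsGridContinuous (fun x _ => κ x) K := by
  obtain ⟨S, hS, hc⟩ := h.continuousAt
  exact ⟨h.measurable.comp measurable_fst, fun x _ => h.bound x, S, hS, fun x t hx _ =>
    ContinuousAt.comp (f := fun p : ℝ × ℝ => p.1) (x := (x, t)) (hc x hx) continuousAt_fst⟩

lemma gridContinuous_snd (h : IsPiecewiseContinuous κ K) : IsGridContinuous (fun _ t => κ t) K := by
  obtain ⟨S, hS, hc⟩ := h.continuousAt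
  exact ⟨h.measurable.comp measurable_snd, fun _ t => h.bound t, S, hS, fun x t _ ht =>
    ContinuousAt.comp (f := fun p : ℝ × ℝ => p.2) (x := (x, t)) (hc t ht) continuousAt_snd⟩

lemma comp_sub_left (h : IsPiecewiseContinuous κ K) (b : ℝ) :
    IsPiecewiseContinuous (fun x => κ (b - x)) K := by
  obtain ⟨S, hS, hc⟩ := h.continuousAt
  refine ⟨h.measurable.comp (measurable_const.sub measurable_id), fun x => h.bound _,
    (fun x => b - x) ⁻¹' S, hS.preimage sub_right_injective, fun x hx => ?_⟩
  exact ContinuousAt.comp (f := fun x : ℝ => b - x) (hc (b - x) hx) (by fun_prop)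

/-- The reflection about `b` of the restriction to `x ≤ b`. -/
lemma comp_fold (h : IsPiecewiseContinuous κ K) (b : ℝ) :
    IsPiecewiseContinuous (fun x => κ (b - |x - b|)) K := by
  obtain ⟨S, hS, hc⟩ := h.continuousAt
  have hcont : Continuous fun x : ℝ => b - |x - b| := by fun_prop
  refine ⟨h.measurable.comp hcont.measurable, fun x => h.bound _,
    S ∪ (fun x => 2 * b - x) ⁻¹' S, hS.union (hS.preimage sub_right_injective), fun x hx => ?_⟩
  simp only [mem_union, mem_preimage, not_or] at hx
  have : b - |x - b| ∉ S := by
    rcases abs_choice (x - b) with h | h <;> rw [h]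
    · rw [show b - (x - b) = 2 * b - x by ring]
      exact hx.2
    · rw [show b - -(x - b) = x by ring]
      exact hx.1
  exact ContinuousAt.comp (f := fun x : ℝ => b - |x - b|) (hc _ this) hcont.continuousAt

lemma neg (h : IsPiecewiseContinuous κ K) : IsPiecewiseContinuous (fun x => -κ x) K := by
  obtain ⟨S, hS, hc⟩ := h.continuousAt
  exact ⟨h.measurable.neg, fun x => by simpa using h.bound x, S, hS, fun x hx => (hc x hx).neg⟩

lemma of_continuous (hc : Continuous κ) (hK : ∀ x, |κ x| ≤ K) : IsPiecewiseContinuous κ K :=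
  ⟨hc.measurable, hK, ∅, countable_empty, fun _ _ => hc.continuousAt⟩

/-- Gluing at the origin. -/
lemma ite {κ' : ℝ → ℝ} (h : IsPiecewiseContinuous κ K) (h' : IsPiecewiseContinuous κ' K) :
    IsPiecewiseContinuous (fun x => if 0 < x then κ x else κ' x) K := by
  obtain ⟨S, hS, hc⟩ := h.continuousAt
  obtain ⟨S', hS', hc'⟩ := h'.continuousAt
  refine ⟨Measurable.ite measurableSet_Ioi h.measurable h'.measurable, fun x => ?_,
    insert 0 (S ∪ S'), (hS.union hS').insert 0, fun x hx => ?_⟩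
  · split_ifs
    · exact h.bound x
    · exact h'.bound x
  · simp only [mem_insert_iff, mem_union, not_or] at hx
    rcases lt_or_gt_of_ne hx.1 with hx0 | hx0
    · refine (hc' x hx.2.2).congr ?_
      filter_upwards [Iio_mem_nhds hx0] with y hy
      exact (if_neg (not_lt.2 (le_of_lt hy))).symm
    · refine (hc x hx.2.1).congr ?_
      filter_upwards [Ioi_mem_nhds hx0] with y hy
      exact (if_pos hy).symm

end IsPiecewiseContinuous

lemma isPiecewiseContinuous_sign (c : ℝ) :
    IsPiecewiseContinuous (fun x => Real.sign (x - c)) 1 := by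
  have h1 : ∀ x, |Real.sign x| ≤ 1 := fun x => by
    rcases Real.sign_apply_eq x with h | h | h <;> simp [h]
  have hm : Measurable Real.sign := by
    unfold Real.sign
    exact Measurable.ite measurableSet_Iio measurable_const
      (Measurable.ite measurableSet_Ioi measurable_const measurable_const)
  refine ⟨hm.comp (measurable_id.sub_const c), fun x => h1 _, {c}, countable_singleton c,
    fun x hx => ?_⟩
  rcases lt_or_gt_of_ne (show x ≠ c from hx) with hx0 | hx0
  · refine (continuousAt_const (y := (-1 : ℝ))).congr ?_
    filter_upwards [Iio_mem_nhds hx0] with y hy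
    rw [Real.sign_of_neg (by simpa using hy)]
  · refine (continuousAt_const (y := (1 : ℝ))).congr ?_
    filter_upwards [Ioi_mem_nhds hx0] with y hy
    rw [Real.sign_of_pos (by simpa using hy)]

lemma isGridContinuous_pos_time :
    IsGridContinuous (fun _ t => if 0 < t then (1 : ℝ) else 0) 1 :=
  (IsPiecewiseContinuous.ite (.of_continuous (κ := fun _ => (1 : ℝ)) continuous_const (by simp))
    (.of_continuous (κ := fun _ => (0 : ℝ)) continuous_const (by simp))).gridContinuous_snd

/-- Shape control of a string `[α, b]`, by its value at `α`, without reflection at `b`. The wave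
`ψ (s + T - t) + R s t` vanishes for `b - s ≤ T - t` and has the shape `ψ` at the time `T`. It is
found by exchanging the roles of space and time: with the distance to `b` as time and the
distance to `T` as position, the shape is a boundary datum, and the condition is that the initial
state is zero. -/
theorem exists_shape_control_wave {κ : ℝ → ℝ} {K α b : ℝ} (hκ : IsPiecewiseContinuous κ K)
    (hαb : α ≤ b) (T : ℝ) :
    ∃ C, 0 ≤ C ∧ ∀ (ψ ψ' : ℝ → ℝ) (A : ℝ), IsH1Bounded ψ ψ' A → (∀ y, b ≤ y → ψ y = 0) →
      ∃ R Rx Rt f : ℝ → ℝ → ℝ, C1Wave R Rx Rt f ∧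
        (∀ s t, b - s ≤ T - t → R s t = 0) ∧ (∀ s, R s T = 0) ∧
        (∀ s t, α ≤ s → |R s t| ≤ C * A ∧ |Rx s t| ≤ C * A ∧ |Rt s t| ≤ C * A) ∧
        (∀ s t, α ≤ s → s < b → t < T → f s t = -(κ s * (ψ (s + T - t) + R s t))) := by
  -- the potential changes sign when space and time are exchanged
  have hk := (isGridContinuous_pos_time.mul (hκ.comp_sub_left b).gridContinuous_snd).mono
    (one_mul K).le
  obtain ⟨C, hC, hV⟩ := exists_volterra_wave hk (fun x t ht => by simp [not_lt.2 ht])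
    (sub_nonneg.2 hαb)
  refine ⟨C, hC, fun ψ ψ' A hψ hψb => ?_⟩
  -- the incident wave is extended as an odd function of the distance to `T`, so that the scattered
  -- wave, being odd too, does not change the shape at the time `T`
  have hW : IsGridContinuous (fun σ τ => Real.sign (σ - 0) * ψ (b - τ + |σ|)) A :=
    ((isPiecewiseContinuous_sign 0).gridContinuous_fst.mul
      (IsGridContinuous.of_continuous (f := fun σ τ => ψ (b - τ + |σ|))
        (hψ.continuous.comp (by fun_prop)) fun x t => hψ.bound _)).mono (one_mul A).le
  obtain ⟨V, Vx, Vt, f, hwave, -, hf, hbd, hodd, hcone⟩ := hV _ A hW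
  have hcone' := hcone fun x t ht => by rw [hψb _ (by linarith), mul_zero]
  have hodd' := hodd 0 (fun x t => rfl) fun x t => by
    rw [mul_zero, zero_sub, sub_zero, sub_zero, Real.sign_neg, abs_neg]
    ring
  refine ⟨_, _, _, _, hwave.swap T b, fun s t h => hcone' _ _ (h.trans (le_abs_self _)),
    fun s => ?_, fun s t hs => ?_, fun s t hs hsb ht => ?_⟩
  · have := hodd' 0 (b - s)
    simp only [mul_zero, sub_zero] at this
    simp only [sub_self]
    linarith
  · obtain ⟨h1, h2, h3⟩ := hbd (T - t) (b - s) (by linarith)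
    exact ⟨h1, by rwa [abs_neg], by rwa [abs_neg]⟩
  · rw [hf (T - t) (b - s) (by linarith), if_pos (sub_pos.2 hsb), sub_zero,
      Real.sign_of_pos (sub_pos.2 ht), abs_of_pos (sub_pos.2 ht)]
    rw [show b - (b - s) = s by ring, show s + (T - t) = s + T - t by ring]
    ring

/-- The wave produced by a jump `p` of the displacement across `s = 0` on the string
`(-∞, b]` with a fixed end at `b`. It is the sum of the wave of the string without potential, with
the reflection at `b` expressed by a second jump at the mirror point `2 b`, and of `R`. -/
theorem exists_jump_wave {κ : ℝ → ℝ} {K b T : ℝ} (hκ : IsPiecewiseContinuous κ K) (hb : 0 < b)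
    (hT : 0 ≤ T) :
    ∃ C, 0 ≤ C ∧ ∀ (p p' : ℝ → ℝ) (A : ℝ), IsH1Bounded p p' A → (∀ t, t ≤ 0 → p t = 0) →
      ∃ R Rx Rt f : ℝ → ℝ → ℝ, C1Wave R Rx Rt f ∧
        (∀ s t, t ≤ 0 → R s t = 0) ∧ (∀ t, R b t = 0) ∧
        (∀ s t, t ≤ T → |R s t| ≤ C * A ∧ |Rx s t| ≤ C * A ∧ |Rt s t| ≤ C * A) ∧
        (∀ s t, s < 0 → t ≤ T →
          f s t = -(κ s * (-(p (t + s) + p (t - 2 * b + s)) / 2 + R s t))) ∧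
        (∀ s t, 0 < s → s < b → t ≤ T →
          f s t = -(κ s * ((p (t - s) - p (t - 2 * b + s)) / 2 + R s t))) := by
  -- the string is reflected at `b`: with an even potential and odd waves, the end `b` is fixed
  have hk := (isGridContinuous_pos_time.mul (hκ.comp_fold b).neg.gridContinuous_fst).mono
    (one_mul K).le
  obtain ⟨C, hC, hV⟩ := exists_volterra_wave hk (fun x t ht => by simp [not_lt.2 ht]) hT
  refine ⟨C, hC, fun p p' A hp hp0 => ?_⟩
  have hW1 : ∀ c, IsGridContinuous (fun s t => Real.sign (s - c) * (p (t - |s - c|) / 2))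
      (A / 2) := fun c =>
    ((isPiecewiseContinuous_sign c).gridContinuous_fst.mul
      (IsGridContinuous.of_continuous (f := fun s t => p (t - |s - c|) / 2) (M := A / 2)
        ((hp.continuous.comp (by fun_prop)).div_const 2) fun x t => by
          rw [abs_div, abs_two]
          linarith [hp.bound (t - |x - c|)])).mono (one_mul _).le
  obtain ⟨R, Rx, Rt, f, hwave, hR0, hf, hbd, hodd, -⟩ :=
    hV _ A (((hW1 0).add (hW1 (2 * b))).mono (by linarith))
  have hodd' := hodd b (fun x t => by rw [show 2 * b - x - b = -(x - b) by ring, abs_neg])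
    fun x t => by
      rw [show 2 * b - x - 0 = -(x - 2 * b) by ring, show 2 * b - x - 2 * b = -(x - 0) by ring,
        Real.sign_neg, Real.sign_neg, abs_neg, abs_neg]
      ring
  refine ⟨R, Rx, Rt, f, hwave, hR0, fun t => ?_, hbd, fun s t hs ht => ?_,
    fun s t hs hsb ht => ?_⟩
  · have := hodd' b t
    rw [show 2 * b - b = b by ring] at this
    linarith
  · rw [hf s t ht]
    rcases le_or_gt t 0 with h | h
    · rw [if_neg (not_lt.2 h), hR0 s t h, hp0 (t + s) (by linarith),
        hp0 (t - 2 * b + s) (by linarith)]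
      ring
    · rw [if_pos h, sub_zero, Real.sign_of_neg hs, Real.sign_of_neg (by linarith), abs_of_neg hs,
        abs_of_neg (show s - 2 * b < 0 by linarith), abs_of_neg (show s - b < 0 by linarith)]
      rw [show b - -(s - b) = s by ring, show t - -s = t + s by ring,
        show t - -(s - 2 * b) = t - 2 * b + s by ring]
      ring
  · rw [hf s t ht]
    rcases le_or_gt t 0 with h | h
    · rw [if_neg (not_lt.2 h), hR0 s t h, hp0 (t - s) (by linarith),
        hp0 (t - 2 * b + s) (by linarith)]
      ring
    · rw [if_pos h, sub_zero, Real.sign_of_pos hs, Real.sign_of_neg (by linarith), abs_of_pos hs,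
        abs_of_neg (show s - 2 * b < 0 by linarith), abs_of_neg (show s - b < 0 by linarith)]
      rw [show b - -(s - b) = s by ring,
        show t - -(s - 2 * b) = t - 2 * b + s by ring]
      ring

/-! ### Edges of the star -/

/-- A primitive that is zero before `c` has a density that is zero before `c`. -/
lemma IsH1Bounded.ae_eq_zero {F F' : ℝ → ℝ} {A c : ℝ} (h : IsH1Bounded F F' A)
    (h0 : ∀ r ≤ c, F r = 0) : ∀ᵐ r, r < c → F' r = 0 := by
  have hli : LocallyIntegrable F' volume := h.memLp.locallyIntegrable (by norm_num)
  filter_upwards [_root_.LocallyIntegrable.ae_hasDerivAt_integral hli] with r hr hrc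
  have h1 : HasDerivAt F (F' r) r := by
    have : F = fun x => F 0 + ∫ y in (0 : ℝ)..x, F' y := by
      ext x
      rw [← h.integral]
      ring
    rw [this]
    exact (hr 0).const_add _
  have h2 : HasDerivAt F 0 r := (hasDerivAt_const r (0 : ℝ)).congr_of_eventuallyEq (by
    filter_upwards [Iio_mem_nhds hrc] with x hx using h0 x (le_of_lt hx))
  exact h1.unique h2

/-- The wave `F (t - x) + G (t + x) + R x t` on the edge `[0, l]`: it solves
`u_tt - u_xx + q u = 0` up to the time `T`, each of its three parts is zero on the edge for `t ≤ 0`,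
and the parts and their derivatives are controlled by `A`. -/
structure IsEdgeWave (l T : ℝ) (q F F' G G' : ℝ → ℝ) (R Rx Rt f : ℝ → ℝ → ℝ) (A : ℝ) : Prop where
  right : IsH1Bounded F F' A
  left : IsH1Bounded G G' A
  wave : C1Wave R Rx Rt f
  right_zero : ∀ r ≤ 0, F r = 0
  left_zero : ∀ r ≤ l, G r = 0
  wave_zero : ∀ x ∈ Icc 0 l, ∀ t ≤ 0, R x t = 0
  bound : ∀ x ∈ Icc 0 l, ∀ t ≤ T, |R x t| ≤ A ∧ |Rx x t| ≤ A ∧ |Rt x t| ≤ A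
  source : ∀ x ∈ Ioo 0 l, ∀ t < T, f x t = -(q x * (F (t - x) + G (t + x) + R x t))

/-- Translation in time: a function that is zero before the time `0` and bounded up to the time
`T`, delayed by `δ`. -/
lemma eLpNorm_delay_le {h : ℝ → ℝ} {B T δ : ℝ} (hT : 0 ≤ T)
    (h0 : ∀ t ≤ 0, h t = 0) (hb : ∀ t ≤ T, |h t| ≤ B) :
    eLpNorm (fun t => h (t - δ)) 2 (volume.restrict (Ioo 0 (T + δ))) ≤ ENNReal.ofReal (B * √T) := by
  have e : (fun t => h (t - δ)) = (Ioi δ).indicator fun t => h (t - δ) := by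
    ext t
    by_cases ht : t ∈ Ioi δ
    · rw [indicator_of_mem ht]
    · rw [indicator_of_notMem ht, h0 _ (by simpa using ht)]
  rw [e, eLpNorm_indicator_eq_eLpNorm_restrict measurableSet_Ioi,
    Measure.restrict_restrict measurableSet_Ioi]
  have hsub : Ioi δ ∩ Ioo 0 (T + δ) ⊆ Ioo δ (T + δ) := fun t ht => ⟨ht.1, ht.2.2⟩
  refine (eLpNorm_mono_measure _ (Measure.restrict_mono_set volume hsub)).trans ?_
  have := eLpNorm_restrict_le_of_bounded (h := fun t => h (t - δ)) (a := δ) (b := T + δ) (B := B)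
    (by linarith) fun t ht => hb _ (by linarith [ht.2])
  rwa [show T + δ - δ = T by ring] at this

namespace IsEdgeWave

variable {l T : ℝ} {q F F' G G' : ℝ → ℝ} {R Rx Rt f : ℝ → ℝ → ℝ} {A : ℝ}

lemma energyWave (h : IsEdgeWave l T q F F' G G' R Rx Rt f A) (δ : ℝ) :
    EnergyWave (fun x t => F (t - δ - x) + G (t - δ + x) + R x (t - δ))
      (fun x t => -F' (t - δ - x) + G' (t - δ + x) + Rx x (t - δ))
      (fun x t => F' (t - δ - x) + G' (t - δ + x) + Rt x (t - δ))
      (fun x t => f x (t - δ)) := by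
  have := (((h.right.translate δ).energyWave).add ((h.left.translate δ).energyWave_left)).add
    (h.wave.timeShift δ).energyWave
  have e1 : ∀ t x : ℝ, t - x - δ = t - δ - x := fun t x => by ring
  have e2 : ∀ t x : ℝ, t + x - δ = t - δ + x := fun t x => by ring
  simpa [e1, e2] using this

/-- An edge wave, delayed by `δ`, is a weak solution. -/
theorem isWeakEdgeSolution (h : IsEdgeWave l T q F F' G G' R Rx Rt f A) (hl : 0 < l) {δ : ℝ}
    (hδ : 0 ≤ δ) :
    IsWeakEdgeSolution l (T + δ) q (fun t => -F' (t - δ) + G' (t - δ) + Rx 0 (t - δ))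
      (fun t x => F (t - δ - x) + G (t - δ + x) + R x (t - δ)) := by
  have := (h.energyWave δ).isWeakEdgeSolution (T := T + δ) hl (q := q) ?_ ?_ ?_
  · simpa using this
  · intro x hx
    simp only [zero_sub]
    rw [h.right_zero _ (by linarith [hx.1]), h.left_zero _ (by linarith [hx.2]),
      h.wave_zero x hx _ (by linarith)]
    ring
  · have k1 := (Measure.measurePreserving_sub_left volume (-δ)).quasiMeasurePreserving.ae
      (h.right.ae_eq_zero h.right_zero)
    have k2 := (measurePreserving_sub_right volume δ).quasiMeasurePreserving.ae
      (h.left.ae_eq_zero h.left_zero)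
    rw [ae_restrict_iff' measurableSet_Ioo]
    filter_upwards [k1, k2] with x h1 h2 hx
    simp only [zero_sub]
    rw [h1 (by linarith [hx.1]), show -δ + x = x - δ by ring, h2 (by linarith [hx.2]),
      (h.wave.deriv_eq_zero hl h.wave_zero (Ioo_subset_Icc_self hx) (by linarith)).2]
    ring
  · intro x hx t ht
    exact h.source x hx (t - δ) (by linarith [ht.2])

/-- The `L²` bound for the derivatives of an edge wave at a fixed position. -/
lemma eLpNorm_le {F G w : ℝ → ℝ} {A T δ c : ℝ} (hF : Measurable F) (hG : Measurable G)
    (hFn : eLpNorm F 2 volume ≤ ENNReal.ofReal A) (hGn : eLpNorm G 2 volume ≤ ENNReal.ofReal A)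
    (hw : Measurable w) (hA : 0 ≤ A) (hT : 0 ≤ T) (h0 : ∀ t ≤ 0, w t = 0)
    (hb : ∀ t ≤ T, |w t| ≤ A) :
    eLpNorm (fun t => F (t - δ - c) + G (t - δ + c) + w (t - δ)) 2
      (volume.restrict (Ioo 0 (T + δ))) ≤ ENNReal.ofReal ((2 + √T) * A) := by
  have hsub : ∀ {F : ℝ → ℝ} (c : ℝ), Measurable F → eLpNorm F 2 volume ≤ ENNReal.ofReal A →
      eLpNorm (fun t => F (t - δ - c)) 2 (volume.restrict (Ioo 0 (T + δ))) ≤ ENNReal.ofReal A := by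
    intro F c hF hFn
    refine (eLpNorm_mono_measure _ Measure.restrict_le_self).trans ?_
    have := eLpNorm_comp_measurePreserving (p := 2) hF.aestronglyMeasurable
      (measurePreserving_sub_right (volume : Measure ℝ) (δ + c))
    simp only [Function.comp_def, ← sub_sub] at this
    rw [this]
    exact hFn
  have m1 : Measurable fun t : ℝ => F (t - δ - c) := by fun_prop
  have m2 : Measurable fun t : ℝ => G (t - δ + c) := by fun_prop
  have m3 : Measurable fun t : ℝ => w (t - δ) := by fun_prop
  have k2 := hsub (-c) hG hGn
  simp only [sub_neg_eq_add] at k2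
  refine (eLpNorm_add_le (m1.add m2).aestronglyMeasurable m3.aestronglyMeasurable
    (by norm_num)).trans ?_
  refine (add_le_add (eLpNorm_add_le m1.aestronglyMeasurable m2.aestronglyMeasurable
    (by norm_num)) le_rfl).trans ?_
  refine (add_le_add (add_le_add (hsub c hF hFn) k2) (eLpNorm_delay_le hT h0 hb)).trans ?_
  rw [← ENNReal.ofReal_add hA hA, ← ENNReal.ofReal_add (by positivity) (by positivity)]
  exact ENNReal.ofReal_le_ofReal (by linarith)

lemma eLpNorm_trace_le (h : IsEdgeWave l T q F F' G G' R Rx Rt f A) (hl : 0 < l) (hT : 0 ≤ T)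
    (δ : ℝ) :
    eLpNorm (fun t => -F' (t - δ) + G' (t - δ) + Rx 0 (t - δ)) 2
      (volume.restrict (Ioo 0 (T + δ))) ≤ ENNReal.ofReal ((2 + √T) * A) := by
  have h0 : (0 : ℝ) ∈ Icc 0 l := left_mem_Icc.2 hl.le
  have := eLpNorm_le (c := 0) (δ := δ) h.right.neg.measurable h.left.measurable h.right.neg.norm_le
    h.left.norm_le (h.wave.continuous_x_right 0).measurable h.right.nonneg hT
    (fun t ht => (h.wave.deriv_eq_zero hl h.wave_zero h0 ht).1)
    (fun t ht => (h.bound 0 h0 t ht).2.1)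
  simpa using this

/-- The value at the leaf `l` of an edge wave, delayed by `δ`, as a boundary control. -/
lemma leaf_control (h : IsEdgeWave l T q F F' G G' R Rx Rt f A) (hl : 0 < l) (hT : 0 ≤ T)
    {δ : ℝ} (hδ : 0 ≤ δ) (hend : F (T - l) + G (T + l) + R l T = 0) :
    MemH10 0 (T + δ) (fun t => F (t - δ - l) + G (t - δ + l) + R l (t - δ)) ∧
      h1Norm 0 (T + δ) (fun t => F (t - δ - l) + G (t - δ + l) + R l (t - δ))
        ≤ (2 + 4 * √T) * A := by
  set w : ℝ → ℝ := fun t => F (t - δ - l) + G (t - δ + l) + R l (t - δ) with hw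
  have hTδ : 0 ≤ T + δ := by linarith
  have hA := h.right.nonneg
  have hll : l ∈ Icc 0 l := right_mem_Icc.2 hl.le
  have he := h.energyWave δ
  obtain ⟨hac, hder⟩ := absolutelyContinuous_of_integral (F := w) hTδ
    (he.integrable_tr l 0 (T + δ)) fun t => he.time l 0 t
  have hd : deriv w =ᵐ[volume.restrict (Ioo 0 (T + δ))]
      fun t => F' (t - δ - l) + G' (t - δ + l) + Rt l (t - δ) := by
    filter_upwards [hder] with t ht using ht.deriv
  have hdn : eLpNorm (deriv w) 2 (volume.restrict (Ioo 0 (T + δ)))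
      ≤ ENNReal.ofReal ((2 + √T) * A) := by
    rw [eLpNorm_congr_ae hd]
    exact eLpNorm_le h.right.measurable h.left.measurable h.right.norm_le h.left.norm_le
      (h.wave.continuous_t_right l).measurable h.right.nonneg hT
      (fun t ht => (h.wave.deriv_eq_zero hl h.wave_zero hll ht).2)
      (fun t ht => (h.bound l hll t ht).2.2)
  have hwc : Continuous w :=
    he.continuous.comp (continuous_const.prodMk continuous_id : Continuous fun t : ℝ => (l, t))
  have hmd : MemL2 0 (T + δ) (deriv w) :=
    (memLp_congr_ae hd).2 (he.trace_t 0 (T + δ) l)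
  have hneg : ∀ t ≤ δ, w t = 0 := by
    intro t ht
    simp only [hw]
    rw [h.right_zero _ (by linarith), h.left_zero _ (by linarith),
      h.wave_zero l hll _ (by linarith)]
    ring
  have hwn : eLpNorm w 2 (volume.restrict (Ioo 0 (T + δ))) ≤ ENNReal.ofReal (3 * A * √T) := by
    have := eLpNorm_delay_le (h := fun t => w (t + δ)) (B := 3 * A) (T := T) (δ := δ) hT
      (fun t ht => hneg _ (by linarith)) (fun t ht => by
        simp only [hw, add_sub_cancel_right]
        have b1 := abs_le.1 (h.right.bound (t - l))
        have b2 := abs_le.1 (h.left.bound (t + l))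
        have b3 := abs_le.1 (h.bound l hll t ht).1
        rw [abs_le]
        constructor <;> linarith [b1.1, b1.2, b2.1, b2.2, b3.1, b3.2])
    simpa using this
  refine ⟨⟨⟨hac, hmd⟩, hneg 0 hδ, ?_⟩, ?_⟩
  · simp only [hw, add_sub_cancel_right]
    exact hend
  · refine (h1Norm_le hTδ hmd (hwc.memL2 _ _)).trans ?_
    have k1 := l2Norm_le_of_eLpNorm_le hTδ (by positivity) hmd.1 hdn
    have k2 := l2Norm_le_of_eLpNorm_le hTδ (by positivity) hwc.aestronglyMeasurable hwn
    linarith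

end IsEdgeWave

/-! ### The star -/

/-- The restriction to `[a, b]` of a continuously differentiable function, extended by
constants. -/
lemma isH1Bounded_clamp {F F' : ℝ → ℝ} {a b B : ℝ} (hab : a ≤ b) (hc : Continuous F')
    (hF : ∀ x y, F y - F x = ∫ z in x..y, F' z) (hb : ∀ x ∈ Icc a b, |F x| ≤ B)
    (hb' : ∀ x ∈ Icc a b, |F' x| ≤ B) :
    IsH1Bounded (fun x => F (max a (min x b))) ((Ioo a b).indicator F') (B * (1 + √(b - a))) := by
  have hB : 0 ≤ B := (abs_nonneg _).trans (hb a (left_mem_Icc.2 hab))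
  have hs := Real.sqrt_nonneg (b - a)
  refine IsH1Bounded.of_clamp hab hc.measurable
    ((eLpNorm_restrict_le_of_bounded hab fun x hx => hb' x (Ioo_subset_Icc_self hx)).trans
      (ENNReal.ofReal_le_ofReal (by nlinarith))) (fun x _ y _ => hF x y)
    fun x hx => (hb x hx).trans (by nlinarith)

lemma IsH1Bounded.clamp {F F' : ℝ → ℝ} {a b A : ℝ} (hab : a ≤ b) (h : IsH1Bounded F F' A) :
    IsH1Bounded (fun x => F (max a (min x b))) ((Ioo a b).indicator F') A :=
  IsH1Bounded.of_clamp hab h.measurable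
    ((eLpNorm_mono_measure _ Measure.restrict_le_self).trans h.norm_le)
    (fun x _ y _ => h.integral x y) fun x _ => h.bound x

lemma h1Norm_le_starH1Norm (ℓ : Fin 3 → ℝ) (φ : Fin 3 → ℝ → ℝ) (j : Fin 3) :
    h1Norm 0 (ℓ j) (φ j) ≤ starH1Norm ℓ φ :=
  Real.le_sqrt_of_sq_le (Finset.single_le_sum (f := fun j => h1Norm 0 (ℓ j) (φ j) ^ 2)
    (fun _ _ => sq_nonneg _) (Finset.mem_univ j))

/-- The extension by constants of a potential. -/
lemma exists_extended_potential {l : ℝ} (hl : 0 < l) {q : ℝ → ℝ}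
    (hq : ContinuousOn q (Icc 0 l)) :
    ∃ K, Continuous (fun x => q (max 0 (min x l))) ∧ ∀ x, |q (max 0 (min x l))| ≤ K := by
  have hc : ∀ x : ℝ, max 0 (min x l) ∈ Icc 0 l := fun x =>
    ⟨le_max_left _ _, max_le hl.le (min_le_right _ _)⟩
  obtain ⟨K, hK⟩ := isCompact_Icc.exists_bound_of_continuousOn hq
  exact ⟨K, hq.comp_continuous (by fun_prop) hc, fun x => hK _ (hc x)⟩

set_option maxHeartbeats 1000000 in
/-- Waves on the three edges that satisfy the conditions at the centre and at the uncontrolled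
leaves, and that have the prescribed shape at the time `max l₂ (l₁ + l₃)`. The edge `1` is
controlled through its value `p` at the centre. The other two edges, with the sign of the wave
changed on the edge `2`, form one string, on which the wave is the sum of the wave produced by
the jump `p` at the centre and of a wave that corrects the shape from the leaf of the edge `0`. -/
theorem exists_star_waves (ℓ : Fin 3 → ℝ) (hℓ : ∀ j, 0 < ℓ j)
    (q : Fin 3 → ℝ → ℝ) (hq : ∀ j, ContinuousOn (q j) (Icc 0 (ℓ j))) {T : ℝ}
    (hT1 : ℓ 1 ≤ T) (hT2 : ℓ 0 + ℓ 2 ≤ T) :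
    ∃ C : ℝ, ∀ φ : Fin 3 → ℝ → ℝ, MemStarH10 ℓ φ →
      ∃ (F F' G G' : Fin 3 → ℝ → ℝ) (R Rx Rt f : Fin 3 → ℝ → ℝ → ℝ),
        (∀ j, IsEdgeWave (ℓ j) T (q j) (F j) (F' j) (G j) (G' j) (R j) (Rx j) (Rt j) (f j)
          (C * starH1Norm ℓ φ)) ∧
        (∀ j, ∀ x ∈ Icc 0 (ℓ j), F j (T - x) + G j (T + x) + R j x T = φ j x) ∧
        (∀ t ≤ T, F 1 (t - ℓ 1) + G 1 (t + ℓ 1) + R 1 (ℓ 1) t = 0) ∧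
        (∀ t ≤ T, F 2 (t - ℓ 2) + G 2 (t + ℓ 2) + R 2 (ℓ 2) t = 0) ∧
        (∀ t ≤ T, ∑ j, (F j t + G j t + R j 0 t) = 0) ∧
        (∀ t, -F' 2 t + G' 2 t + Rx 2 0 t = -F' 0 t + G' 0 t + Rx 0 0 t) := by
  have hl0 := hℓ 0
  have hl1 := hℓ 1
  have hl2 := hℓ 2
  have hT : 0 ≤ T := hl1.le.trans hT1
  set b := ℓ 2 with hb
  obtain ⟨K0, hq0c, hq0b⟩ := exists_extended_potential hl0 (hq 0)
  obtain ⟨K1, hq1c, hq1b⟩ := exists_extended_potential hl1 (hq 1)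
  obtain ⟨K2, hq2c, hq2b⟩ := exists_extended_potential hl2 (hq 2)
  -- the potential of the string made of the edges `0` and `2`, with the centre at the origin
  set κ : ℝ → ℝ := fun s =>
    if 0 < s then q 2 (max 0 (min s b)) else q 0 (max 0 (min (-s) (ℓ 0))) with hκdef
  have hκ : IsPiecewiseContinuous κ (max K0 K2) :=
    IsPiecewiseContinuous.ite (.of_continuous hq2c fun x => (hq2b x).trans (le_max_right _ _))
      (.of_continuous (κ := fun s => q 0 (max 0 (min (-s) (ℓ 0)))) (hq0c.comp continuous_neg)
        fun x => (hq0b (-x)).trans (le_max_left _ _))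
  obtain ⟨C1, hC1, hV1⟩ := exists_shape_control_wave (.of_continuous hq1c hq1b) hl1.le T
  obtain ⟨C2, hC2, hV2⟩ := exists_jump_wave hκ hl2 hT
  obtain ⟨C3, hC3, hV3⟩ := exists_shape_control_wave hκ (α := -ℓ 0) (b := b) (by linarith) T
  set c0 : ℝ := 1 + √(ℓ 0) + √(ℓ 1) + √(ℓ 2) with hc0
  set cp : ℝ := c0 + C1 * c0 * (1 + √T) with hcp
  set cψ : ℝ := 3 * c0 + 2 * cp + C2 * cp * (1 + √(b - -ℓ 0)) with hcψ
  refine ⟨c0 + C1 * c0 + cp + cψ + C2 * cp + C3 * cψ, fun φ hφ => ?_⟩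
  obtain ⟨hφ1, hφl, hφ0⟩ := hφ
  rw [Fin.sum_univ_three] at hφ0
  set N := starH1Norm ℓ φ with hN
  have hN0 : 0 ≤ N := Real.sqrt_nonneg _
  have hc0p : 0 ≤ c0 := by positivity
  have hcpp : 0 ≤ cp := by positivity
  have hcψp : 0 ≤ cψ := by positivity
  -- the shapes, extended by constants
  set Φ : Fin 3 → ℝ → ℝ := fun j x => φ j (max 0 (min x (ℓ j))) with hΦdef
  set Φ' : Fin 3 → ℝ → ℝ := fun j => (Ioo 0 (ℓ j)).indicator (deriv (φ j)) with hΦ'def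
  have hsq : ∀ j, √(ℓ j) ≤ √(ℓ 0) + √(ℓ 1) + √(ℓ 2) := by
    intro j
    have h0 := Real.sqrt_nonneg (ℓ 0)
    have h1 := Real.sqrt_nonneg (ℓ 1)
    have h2 := Real.sqrt_nonneg (ℓ 2)
    fin_cases j <;> simp <;> linarith
  have hΦ : ∀ j, IsH1Bounded (Φ j) (Φ' j) (c0 * N) := fun j =>
    (MemH1.isH1Bounded (hℓ j) (hφ1 j) (hφl j)).mono (mul_le_mul (by linarith [hsq j])
      (h1Norm_le_starH1Norm ℓ φ j) (Real.sqrt_nonneg _) hc0p)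
  have hΦin : ∀ j, ∀ x ∈ Icc 0 (ℓ j), Φ j x = φ j x := fun j x hx => by
    simp only [hΦdef, min_eq_left hx.2, max_eq_right hx.1]
  have hΦr : ∀ j x, ℓ j ≤ x → Φ j x = 0 := fun j x hx => by
    simp only [hΦdef, min_eq_right hx, max_eq_right (hℓ j).le, hφl]
  have hΦl : ∀ j x, x ≤ 0 → Φ j x = φ j 0 := fun j x hx => by
    simp only [hΦdef, max_eq_left ((min_le_left x (ℓ j)).trans hx)]
  -- the edge `1`
  obtain ⟨R1, R1x, R1t, f1, hw1, hz1, hf1, hb1, hs1⟩ := hV1 _ _ _ (hΦ 1) (hΦr 1)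
  have hR1neg : ∀ x t, 0 ≤ x → t ≤ 0 → R1 x t = 0 := fun x t hx ht =>
    hz1 x t (by linarith)
  -- its value at the centre
  set p : ℝ → ℝ := fun t => Φ 1 (T - t) + R1 0 (max 0 (min t T)) with hpdef
  set p' : ℝ → ℝ := fun t => -Φ' 1 (T - t) + (Ioo 0 T).indicator (fun t => R1t 0 t) t with hp'def
  have hp : IsH1Bounded p p' (cp * N) := by
    refine (((hΦ 1).reflect T).add (isH1Bounded_clamp (B := C1 * (c0 * N)) hT
      (hw1.continuous_t_right 0) (fun x y => hw1.time 0 x y) (fun x _ => (hb1 0 x le_rfl).1)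
      fun x _ => (hb1 0 x le_rfl).2.2)).mono (le_of_eq ?_)
    rw [hcp, sub_zero]
    ring
  have hp0 : ∀ t, t ≤ 0 → p t = 0 := fun t ht => by
    simp only [hpdef, max_eq_left ((min_le_left t T).trans ht)]
    rw [hΦr 1 _ (by linarith), hR1neg 0 0 le_rfl le_rfl, add_zero]
  have hpT : ∀ t, T ≤ t → p t = φ 1 0 := fun t ht => by
    simp only [hpdef, min_eq_right ht, max_eq_right hT]
    rw [hΦl 1 _ (by linarith), hf1, add_zero]
  have hpt : ∀ t, t ≤ T → p t = Φ 1 (T - t) + R1 0 t := fun t ht => by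
    simp only [hpdef, min_eq_left ht]
    rcases le_total t 0 with h | h
    · rw [max_eq_left h, hR1neg 0 0 le_rfl le_rfl, hR1neg 0 t le_rfl h]
    · rw [max_eq_right h]
  -- the wave produced by the jump, and the shape that remains to be controlled
  obtain ⟨R2, R2x, R2t, f2, hw2, hz2, hr2, hb2, hs2l, hs2r⟩ := hV2 p p' _ hp hp0
  -- The shape of the jump wave at the time `T` is subtracted from the shape of the string, which is
  -- `Φ 0 (-s)` for `s < 0` and `-Φ 2 s` for `s > 0`. All functions are extended by constants, and
  -- `p = φ 1 0` after `T`, so the constant `φ 2 0 + φ 1 0 / 2` makes one formula valid on both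
  -- sides; on the side `s > 0` this uses that the values of `φ` at the centre add up to zero.
  set Ψ₀ : ℝ → ℝ := fun s => Φ 0 (0 - s) + -Φ 2 s + 1 / 2 * p (s - -T) + -(1 / 2 * p (T - s))
    + 1 / 2 * p (s - (2 * b - T)) + (φ 2 0 + 1 / 2 * φ 1 0) + -R2 (max (-ℓ 0) (min s b)) T with hΨ₀
  have hΨ₀b : ∃ Ψ₀', IsH1Bounded Ψ₀ Ψ₀' (cψ * N) := by
    have h1 := isH1Bounded_clamp (B := C2 * (cp * N)) (a := -ℓ 0) (b := b) (by linarith)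
      (hw2.continuous_x_left T) (fun x y => hw2.space T x y) (fun x _ => (hb2 x T le_rfl).1)
      fun x _ => (hb2 x T le_rfl).2.1
    refine ⟨_, ((((((((hΦ 0).reflect 0).add (hΦ 2).neg).add ((hp.translate (-T)).const_mul _)).add
      ((hp.reflect T).const_mul _).neg).add ((hp.translate (2 * b - T)).const_mul _)).add
      (IsH1Bounded.const (φ 2 0 + 1 / 2 * φ 1 0))).add h1.neg).mono ?_⟩
    have e1 : |φ 2 0 + 1 / 2 * φ 1 0| ≤ c0 * N + 1 / 2 * (cp * N) := by
      have k1 := abs_le.1 ((hΦ 2).bound 0)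
      have k2 := abs_le.1 (hp.bound T)
      rw [hΦl 2 0 le_rfl] at k1
      rw [hpT T le_rfl] at k2
      rw [abs_le]
      constructor <;> linarith [k1.1, k1.2, k2.1, k2.2]
    rw [abs_of_pos (show (0 : ℝ) < 1 / 2 by norm_num), hcψ]
    nlinarith
  obtain ⟨Ψ₀', hΨ₀'⟩ := hΨ₀b
  -- only the restriction to the string matters, and the extension by constants vanishes beyond `b`
  set Ψ : ℝ → ℝ := fun s => Ψ₀ (max (-ℓ 0) (min s b)) with hΨdef
  set Ψ' : ℝ → ℝ := (Ioo (-ℓ 0) b).indicator Ψ₀' with hΨ'def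
  have hΨ : IsH1Bounded Ψ Ψ' (cψ * N) := hΨ₀'.clamp (by linarith)
  have hΨin : ∀ s, -ℓ 0 ≤ s → s ≤ b → Ψ s = Φ 0 (-s) - Φ 2 s + 1 / 2 * p (T + s)
      - 1 / 2 * p (T - s) + 1 / 2 * p (T - 2 * b + s) + (φ 2 0 + 1 / 2 * φ 1 0) - R2 s T := by
    intro s h1 h2
    simp only [hΨdef, min_eq_left h2, max_eq_right h1, hΨ₀]
    rw [show s - -T = T + s by ring, show s - (2 * b - T) = T - 2 * b + s by ring, zero_sub]
    ring
  have hΨr : ∀ s, b ≤ s → Ψ s = 0 := by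
    intro s hs
    have : Ψ s = Ψ b := by simp only [hΨdef, min_eq_right hs, min_self]
    rw [this, hΨin b (by linarith) le_rfl, hΦl 0 _ (by linarith), hΦr 2 b le_rfl,
      hpT (T + b) (by linarith), hr2, show T - 2 * b + b = T - b by ring]
    linarith
  obtain ⟨R3, R3x, R3t, f3, hw3, hz3, hf3, hb3, hs3⟩ := hV3 Ψ Ψ' _ hΨ hΨr
  have n0 : 0 ≤ c0 * N := by positivity
  have n1 : 0 ≤ C1 * (c0 * N) := by positivity
  have n2 : 0 ≤ cp * N := by positivity
  have n3 : 0 ≤ cψ * N := by positivity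
  have n4 : 0 ≤ C2 * (cp * N) := by positivity
  have n5 : 0 ≤ C3 * (cψ * N) := by positivity
  have hA : (c0 + C1 * c0 + cp + cψ + C2 * cp + C3 * cψ) * N
      = c0 * N + C1 * (c0 * N) + cp * N + cψ * N + C2 * (cp * N) + C3 * (cψ * N) := by ring
  set A := (c0 + C1 * c0 + cp + cψ + C2 * cp + C3 * cψ) * N with hAdef
  have hhalf : |(1 / 2 : ℝ)| = 1 / 2 := abs_of_pos (by norm_num)
  have hF0 := ((hp.const_mul (1 / 2)).neg).add ((hp.translate (2 * b)).const_mul (1 / 2)).neg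
  have hF2 := ((hp.const_mul (1 / 2)).neg).add (hΨ.reflect T).neg
  have hG2 := (hp.translate (2 * b)).const_mul (1 / 2)
  have hW23 := hw2.add hw3
  have hzero : ∀ s t, s ≤ b → -ℓ 0 ≤ s → t ≤ 0 → R2 s t + R3 s t = 0 := fun s t h1 h2 ht => by
    rw [hz2 s t ht, hz3 s t (by linarith), add_zero]
  have hbd : ∀ s t, -ℓ 0 ≤ s → t ≤ T → |R2 s t + R3 s t| ≤ A ∧ |R2x s t + R3x s t| ≤ A ∧
      |R2t s t + R3t s t| ≤ A := by
    intro s t hs ht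
    obtain ⟨h1, h2, h3⟩ := hb2 s t ht
    obtain ⟨h1', h2', h3'⟩ := hb3 s t hs
    exact ⟨(abs_add_le _ _).trans (by linarith), (abs_add_le _ _).trans (by linarith),
      (abs_add_le _ _).trans (by linarith)⟩
  -- The three edge waves. The jump wave and the correction `Ψ (s + T - t) + R3 s t` are written with
  -- `x = -s` on the edge `0`, and with `x = s` and the opposite sign on the edge `2`.
  have hedge0 : IsEdgeWave (ℓ 0) T (q 0) (fun r => -(1 / 2 * p r) + -(1 / 2 * p (r - 2 * b)))
      (fun r => -(1 / 2 * p' r) + -(1 / 2 * p' (r - 2 * b))) (fun r => Ψ (T - r))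
      (fun r => -Ψ' (T - r)) (fun x t => R2 (-x) t + R3 (-x) t)
      (fun x t => -(R2x (-x) t + R3x (-x) t)) (fun x t => R2t (-x) t + R3t (-x) t)
      (fun x t => f2 (-x) t + f3 (-x) t) A := by
    refine ⟨hF0.mono (by rw [hhalf]; linarith), (hΨ.reflect T).mono (by linarith), hW23.reflect,
      fun r hr => ?_, fun r hr => hΨr _ (by linarith),
      fun x hx t ht => hzero _ _ (by linarith [hx.1]) (by linarith [hx.2]) ht,
      fun x hx t ht => ?_, fun x hx t ht => ?_⟩
    · rw [hp0 r hr, hp0 _ (by linarith)]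
      ring
    · rw [abs_neg]
      exact hbd (-x) t (by linarith [hx.2]) ht
    · rw [hs2l (-x) t (by linarith [hx.1]) ht.le,
        hs3 (-x) t (by linarith [hx.2]) (by linarith [hx.1]) ht]
      have hκx : κ (-x) = q 0 x := by
        simp only [hκdef]
        rw [if_neg (by linarith [hx.1]), neg_neg, min_eq_left hx.2.le, max_eq_right hx.1.le]
      rw [hκx, show t + -x = t - x by ring, show t - 2 * b + -x = t - x - 2 * b by ring,
        show -x + T - t = T - (t + x) by ring]
      ring
  have hedge1 : IsEdgeWave (ℓ 1) T (q 1) (fun r => Φ 1 (T - r)) (fun r => -Φ' 1 (T - r))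
      (fun _ => 0) (fun _ => 0) R1 R1x R1t f1 A := by
    refine ⟨((hΦ 1).reflect T).mono (by linarith),
      (IsH1Bounded.const 0).mono (by rw [abs_zero]; linarith), hw1,
      fun r hr => hΦr 1 _ (by linarith), fun r hr => rfl, fun x hx t ht => hR1neg x t hx.1 ht,
      fun x hx t ht => ?_, fun x hx t ht => ?_⟩
    · obtain ⟨h1, h2, h3⟩ := hb1 x t hx.1
      exact ⟨by linarith, by linarith, by linarith⟩
    · rw [hs1 x t hx.1.le hx.2 ht, min_eq_left hx.2.le, max_eq_right hx.1.le,
        show x + T - t = T - (t - x) by ring]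
      ring
  have hedge2 : IsEdgeWave (ℓ 2) T (q 2) (fun r => -(1 / 2 * p r) + -Ψ (T - r))
      (fun r => -(1 / 2 * p' r) + -(-Ψ' (T - r))) (fun r => 1 / 2 * p (r - 2 * b))
      (fun r => 1 / 2 * p' (r - 2 * b)) (fun x t => -(R2 x t + R3 x t))
      (fun x t => -(R2x x t + R3x x t)) (fun x t => -(R2t x t + R3t x t))
      (fun x t => -(f2 x t + f3 x t)) A := by
    refine ⟨hF2.mono (by rw [hhalf]; linarith), hG2.mono (by rw [hhalf]; linarith), hW23.neg,
      fun r hr => ?_, fun r hr => ?_,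
      fun x hx t ht => by rw [hzero _ _ hx.2 (by linarith [hx.1]) ht, neg_zero],
      fun x hx t ht => ?_, fun x hx t ht => ?_⟩
    · rw [hp0 r hr, hΨr _ (by linarith)]
      ring
    · rw [hp0 _ (by linarith), mul_zero]
    · simp only [abs_neg]
      exact hbd x t (by linarith [hx.1]) ht
    · rw [hs2r x t hx.1 hx.2 ht.le, hs3 x t (by linarith [hx.1]) hx.2 ht]
      have hκx : κ x = q 2 x := by
        simp only [hκdef]
        rw [if_pos hx.1, min_eq_left hx.2.le, max_eq_right hx.1.le]
      rw [hκx, show t - 2 * b + x = t + x - 2 * b by ring,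
        show x + T - t = T - (t - x) by ring]
      ring
  have hshape0 : ∀ x ∈ Icc 0 (ℓ 0), -(1 / 2 * p (T - x)) + -(1 / 2 * p (T - x - 2 * b))
      + Ψ (T - (T + x)) + (R2 (-x) T + R3 (-x) T) = φ 0 x := by
    intro x hx
    rw [show T - (T + x) = -x by ring, hΨin (-x) (by linarith [hx.2]) (by linarith [hx.1]),
      hf3, neg_neg, hΦin 0 x hx, hΦl 2 (-x) (by linarith [hx.1]), show T + -x = T - x by ring,
      show T - 2 * b + -x = T - x - 2 * b by ring, hpT (T - -x) (by linarith [hx.1])]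
    ring
  have hshape1 : ∀ x ∈ Icc 0 (ℓ 1), Φ 1 (T - (T - x)) + 0 + R1 x T = φ 1 x := by
    intro x hx
    rw [show T - (T - x) = x by ring, hΦin 1 x hx, hf1]
    ring
  have hshape2 : ∀ x ∈ Icc 0 (ℓ 2), -(1 / 2 * p (T - x)) + -Ψ (T - (T - x))
      + 1 / 2 * p (T + x - 2 * b) + -(R2 x T + R3 x T) = φ 2 x := by
    intro x hx
    rw [show T - (T - x) = x by ring, hΨin x (by linarith [hx.1]) hx.2,
      hf3, hΦin 2 x hx, hΦl 0 (-x) (by linarith [hx.1]),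
      show T - 2 * b + x = T + x - 2 * b by ring, hpT (T + x) (by linarith [hx.1])]
    linarith
  have hleaf1 : ∀ t ≤ T, Φ 1 (T - (t - ℓ 1)) + 0 + R1 (ℓ 1) t = 0 := by
    intro t ht
    rw [hΦr 1 _ (by linarith), hz1 _ _ (by linarith)]
    ring
  have hleaf2 : ∀ t ≤ T, -(1 / 2 * p (t - ℓ 2)) + -Ψ (T - (t - ℓ 2))
      + 1 / 2 * p (t + ℓ 2 - 2 * b) + -(R2 (ℓ 2) t + R3 (ℓ 2) t) = 0 := by
    intro t ht
    rw [hΨr _ (by linarith), hr2, hz3 _ _ (by linarith),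
      show t + ℓ 2 - 2 * b = t - ℓ 2 by rw [hb]; ring]
    ring
  have hcentre : ∀ t ≤ T, -(1 / 2 * p t) + -(1 / 2 * p (t - 2 * b)) + Ψ (T - t)
      + (R2 (-0) t + R3 (-0) t) + (Φ 1 (T - t) + 0 + R1 0 t)
      + (-(1 / 2 * p t) + -Ψ (T - t) + 1 / 2 * p (t - 2 * b) + -(R2 0 t + R3 0 t)) = 0 := by
    intro t ht
    rw [neg_zero]
    linarith [hpt t ht]
  refine ⟨![fun r => -(1 / 2 * p r) + -(1 / 2 * p (r - 2 * b)), fun r => Φ 1 (T - r),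
      fun r => -(1 / 2 * p r) + -Ψ (T - r)],
    ![fun r => -(1 / 2 * p' r) + -(1 / 2 * p' (r - 2 * b)), fun r => -Φ' 1 (T - r),
      fun r => -(1 / 2 * p' r) + -(-Ψ' (T - r))],
    ![fun r => Ψ (T - r), fun _ => 0, fun r => 1 / 2 * p (r - 2 * b)],
    ![fun r => -Ψ' (T - r), fun _ => 0, fun r => 1 / 2 * p' (r - 2 * b)],
    ![fun x t => R2 (-x) t + R3 (-x) t, R1, fun x t => -(R2 x t + R3 x t)],
    ![fun x t => -(R2x (-x) t + R3x (-x) t), R1x, fun x t => -(R2x x t + R3x x t)],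
    ![fun x t => R2t (-x) t + R3t (-x) t, R1t, fun x t => -(R2t x t + R3t x t)],
    ![fun x t => f2 (-x) t + f3 (-x) t, f1, fun x t => -(f2 x t + f3 x t)],
    ?_, ?_, hleaf1, hleaf2, ?_, ?_⟩
  · intro j
    fin_cases j
    exacts [hedge0, hedge1, hedge2]
  · intro j
    fin_cases j
    exacts [hshape0, hshape1, hshape2]
  · intro t ht
    rw [Fin.sum_univ_three]
    exact hcentre t ht
  · intro t
    simp only [Matrix.cons_val_zero, Matrix.cons_val]
    rw [neg_zero]
    ring

theorem theorem3 (ℓ : Fin 3 → ℝ) (hℓ : ∀ j, 0 < ℓ j)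
    (q : Fin 3 → ℝ → ℝ) (hq : ∀ j, ContinuousOn (q j) (Icc 0 (ℓ j))) :
    ∃ C : ℝ, ∀ T : ℝ, max (ℓ 1) (ℓ 0 + ℓ 2) ≤ T →
      ∀ φ : Fin 3 → ℝ → ℝ, MemStarH10 ℓ φ →
        ∃ f₁ f₂ : ℝ → ℝ, MemH10 0 T f₁ ∧ MemL2 0 T f₂ ∧
          (∃ u : Fin 3 → ℝ → ℝ → ℝ, IsStarSolution ℓ q T f₁ f₂ u ∧
            ∀ j, ∀ x ∈ Icc 0 (ℓ j), u j T x = φ j x) ∧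
          h1Norm 0 T f₁ + l2Norm 0 T f₂ ≤ C * starH1Norm ℓ φ := by
  set Tm := max (ℓ 1) (ℓ 0 + ℓ 2) with hTm
  have hTm0 : 0 ≤ Tm := (hℓ 1).le.trans (le_max_left _ _)
  obtain ⟨C, hC⟩ := exists_star_waves ℓ hℓ q hq (le_max_left _ _) (le_max_right _ _)
  refine ⟨(2 + 4 * √Tm) * C + 2 * ((2 + √Tm) * C), fun T hT φ hφ => ?_⟩
  obtain ⟨F, F', G, G', R, Rx, Rt, f, hedge, hshape, hleaf1, hleaf2, hcentre, hg⟩ := hC φ hφ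
  -- the waves start with a delay, so that they take the shape `φ` at the time `T`
  obtain ⟨δ, hδ, rfl⟩ : ∃ δ, 0 ≤ δ ∧ T = Tm + δ := ⟨T - Tm, sub_nonneg.2 hT, by ring⟩
  have hT0 : 0 ≤ Tm + δ := by linarith
  set g : Fin 3 → ℝ → ℝ := fun j t => -F' j (t - δ) + G' j (t - δ) + Rx j 0 (t - δ) with hgdef
  have hsol := fun j => (hedge j).isWeakEdgeSolution (hℓ j) hδ
  have hgL : ∀ j, MemL2 0 (Tm + δ) (g j) := fun j => (hsol j).2.1
  have hgn := fun j => (hedge j).eLpNorm_trace_le (hℓ j) hTm0 δ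
  have hA := (hedge 0).right.nonneg
  obtain ⟨hf1, hf1n⟩ := (hedge 0).leaf_control (hℓ 0) hTm0 hδ (by
    rw [hshape 0 (ℓ 0) (right_mem_Icc.2 (hℓ 0).le)]
    exact hφ.2.1 0)
  refine ⟨_, fun t => g 1 t - g 0 t, hf1, (hgL 1).sub (hgL 0),
    ⟨fun j t x => F j (t - δ - x) + G j (t - δ + x) + R j x (t - δ),
      ⟨⟨g, hsol, Eventually.of_forall fun t => rfl, Eventually.of_forall fun t => ?_⟩,
        fun t _ => rfl, fun t ht => hleaf1 _ (by linarith [ht.2]),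
        fun t ht => hleaf2 _ (by linarith [ht.2]), fun t ht => ?_⟩, fun j x hx => ?_⟩, ?_⟩
  · exact sub_eq_zero.2 (hg (t - δ))
  · simpa using hcentre (t - δ) (by linarith [ht.2])
  · simpa using hshape j x hx
  · have k : l2Norm 0 (Tm + δ) (fun t => g 1 t - g 0 t)
        ≤ 2 * ((2 + √Tm) * (C * starH1Norm ℓ φ)) := by
      refine l2Norm_le_of_eLpNorm_le hT0 (by positivity) ((hgL 1).sub (hgL 0)).1 ?_
      refine (eLpNorm_sub_le (hgL 1).1 (hgL 0).1 (by norm_num)).trans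
        ((add_le_add (hgn 1) (hgn 0)).trans (le_of_eq ?_))
      rw [← ENNReal.ofReal_add (by positivity) (by positivity)]
      congr 1
      ring
    linarith
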